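/- Let $n,s,p$ be positive integers with $n\ge 7s+6$, and let $\mathcal H\subseteq\binom{[n]}{3}$ be a family of $3$-element subsets of $[n]=\{1,\dots,n\}$ with $\nu(\mathcal H)=s$, where the matching number $\nu(\mathcal H)$ is the largest number of pairwise disjoint members of $\mathcal H$. For a family $\mathcal F\subseteq\binom{[n]}{3}$ put $$co_p(\mathcal F)=\sum_{E\in\binom{[n]}{2}}d_{\mathcal F}(E)^p,\qquad d_{\mathcal F}(E)=|\{F\in\mathcal F: E\subseteq F\}|,$$ and let $\mathcal H_{n,3,s}=\{F\in\binom{[n]}{3}: F\cap[s]\neq\emptyset\}$. Then $$co_p(\mathcal H)\le co_p(\mathcal H_{n,3,s}),$$ with equality if and only if $\mathcal H\cong\mathcal H_{n,3,s}$, i.e. if and only if some permutation of $[n]$ maps $\mathcal H$ onto $\mathcal H_{n,3,s}$. -/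

import Mathlib

/-- `[n]` is modelled by `Fin n`; a family of subsets of `[n]` is a `Finset (Finset (Fin n))`.
A matching in `H` is a subfamily whose members are pairwise disjoint. -/
def IsMatchingIn {n : ℕ} (H M : Finset (Finset (Fin n))) : Prop :=
  M ⊆ H ∧ (M : Set (Finset (Fin n))).PairwiseDisjoint id

open Classical in
/-- The matching number `ν(H)`: the largest size of a matching in `H`. -/
noncomputable def matchingNumber {n : ℕ} (H : Finset (Finset (Fin n))) : ℕ :=
  (H.powerset.filter (fun M => IsMatchingIn H M)).sup Finset.card

/-- The codegree `d_H(E)`: the number of members of `H` that contain `E`. -/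
def codegree {n : ℕ} (H : Finset (Finset (Fin n))) (E : Finset (Fin n)) : ℕ :=
  (H.filter (fun F => E ⊆ F)).card

/-- The `ℓ_p`-norm `co_p(H)` of a `k`-uniform family `H`: the sum of the `p`-th powers of the
codegrees of all `(k-1)`-subsets of `[n]`. -/
def coNorm {n : ℕ} (k p : ℕ) (H : Finset (Finset (Fin n))) : ℕ :=
  ∑ E ∈ Finset.powersetCard (k - 1) (Finset.univ : Finset (Fin n)), codegree H E ^ p

/-- `H_{n,k,s}`: all `k`-subsets of `[n]` that meet `[s]`, the set of the first `s` elements. -/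
def starFamily (n k s : ℕ) : Finset (Finset (Fin n)) :=
  (Finset.powersetCard k (Finset.univ : Finset (Fin n))).filter
    (fun F => ∃ i ∈ F, (i : ℕ) < s)

/-- Two families on `[n]` are isomorphic if a permutation of `[n]` carries one to the other. -/
def FamilyIso {n : ℕ} (H K : Finset (Finset (Fin n))) : Prop :=
  ∃ σ : Equiv.Perm (Fin n), H.image (fun F => F.image σ) = K

/-!
Write `d` for the codegree of a pair. The codegrees of the star take only the values `s` and `n - 2`,
and no codegree exceeds `n - 2`. The function `d ↦ d ^ p` lies below the piecewise linear function
`a * d + K * (d - s)⁺` that agrees with it at `0`, `s` and `n - 2` (`exists_chord`), so it suffices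
that the star maximises both the sum of all codegrees, which is three times the number of triples,
and the sum of the excesses `(d - s)⁺`. Since `a ≥ 1`, equality forces the number of triples to be
maximal, and uniqueness is needed for that number only.

Shifting keeps the number of triples, does not decrease the excess (the codegrees of a pair and its
mirror image move apart while keeping their sum) and does not increase the matching number; and a
family that becomes a star under a shift was already a star (`exists_eq_starAt_of_shift`). So the
family may be assumed to be shifted.

For a shifted family, let `U` be the set of the `n - s - 1` vertices after the first `s + 1` ones,
and let `g i` count the pairs in `U` that form a triple with vertex `i ≤ s`. These links are nested
and contain no choice of `s + 1` disjoint pairs, one from each. The pairs in `U` split into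
near-perfect matchings according to their sum modulo `|U|`, and a greedy argument inside each
matching gives `∑ i < s, g i + (2 s + 1) g s ≤ s * (|U| choose 2)`
(`IsShifted.sum_card_linkPairs_le`); this uses that `n` is large compared with `s`. The triples
inside `U` number at most `s * g s` (`IsShifted.sum_upper_le`), because a triple of large vertices
would dominate `s + 1` disjoint triples. All pairs and triples with at least two vertices among the
first `s + 1` contribute no more than in the star, and the two estimates bound the rest
(`IsShifted.compare`), with room to spare unless `g s = 0`, in which case the family lies inside the
star.
-/

/-! ### Shifting -/

/-- The image of a set of vertices under the transposition of `i` and `j`. -/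
def swapSet {n : ℕ} (i j : Fin n) (F : Finset (Fin n)) : Finset (Fin n) :=
  F.image (Equiv.swap i j)

theorem mem_swapSet {n : ℕ} {i j x : Fin n} {F : Finset (Fin n)} :
    x ∈ swapSet i j F ↔ Equiv.swap i j x ∈ F := by
  unfold swapSet
  rw [Finset.mem_image]
  constructor
  · rintro ⟨y, hy, rfl⟩
    simpa using hy
  · intro h
    exact ⟨_, h, by simp⟩

theorem swapSet_swapSet {n : ℕ} (i j : Fin n) (F : Finset (Fin n)) :
    swapSet i j (swapSet i j F) = F := by
  ext x
  simp [mem_swapSet]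

theorem card_swapSet {n : ℕ} (i j : Fin n) (F : Finset (Fin n)) :
    (swapSet i j F).card = F.card :=
  Finset.card_image_of_injective _ (Equiv.injective _)

theorem swapSet_subset_iff {n : ℕ} {i j : Fin n} {E F : Finset (Fin n)} :
    swapSet i j E ⊆ swapSet i j F ↔ E ⊆ F :=
  Finset.image_subset_image_iff (Equiv.injective _)

theorem swapSet_eq_self {n : ℕ} {i j : Fin n} {F : Finset (Fin n)} (h : i ∈ F ↔ j ∈ F) :
    swapSet i j F = F := by
  ext x
  rw [mem_swapSet]
  rcases eq_or_ne x i with rfl | hi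
  · rw [Equiv.swap_apply_left, h]
  rcases eq_or_ne x j with rfl | hj
  · rw [Equiv.swap_apply_right, h]
  rw [Equiv.swap_apply_of_ne_of_ne hi hj]

/-- The transposition of `i` and `j` as a permutation of the sets of vertices. -/
def swapPerm {n : ℕ} (i j : Fin n) : Equiv.Perm (Finset (Fin n)) :=
  Function.Involutive.toPerm (swapSet i j) (swapSet_swapSet i j)

/-- The shift of `H` that replaces `j` by `i`. It is described by membership: a set containing `i`
is kept as soon as it or its mirror image lies in `H`, any other set only if both do. When `F`
contains both or none of `i` and `j`, it is its own mirror image and nothing changes. -/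
def shift {n : ℕ} (i j : Fin n) (H : Finset (Finset (Fin n))) : Finset (Finset (Fin n)) :=
  Finset.univ.filter fun F =>
    (F ∈ H ∧ swapSet i j F ∈ H) ∨ (i ∈ F ∧ (F ∈ H ∨ swapSet i j F ∈ H))

theorem mem_shift {n : ℕ} {i j : Fin n} {H : Finset (Finset (Fin n))} {F : Finset (Fin n)} :
    F ∈ shift i j H ↔
      (F ∈ H ∧ swapSet i j F ∈ H) ∨ (i ∈ F ∧ (F ∈ H ∨ swapSet i j F ∈ H)) := by
  simp [shift]

theorem shift_indicator {n : ℕ} (i j : Fin n) (H : Finset (Finset (Fin n)))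
    (F : Finset (Fin n)) :
    (if F ∈ shift i j H then 1 else 0) + (if swapSet i j F ∈ shift i j H then 1 else 0)
      = (if F ∈ H then 1 else 0) + (if swapSet i j F ∈ H then 1 else 0 : ℕ) := by
  by_cases hF : i ∈ F ↔ j ∈ F
  · rw [swapSet_eq_self hF]
    simp only [mem_shift, swapSet_eq_self hF]
    by_cases F ∈ H <;> simp [*]
  · simp only [mem_shift, swapSet_swapSet, mem_swapSet, Equiv.swap_apply_left]
    by_cases h1 : i ∈ F <;> by_cases h2 : j ∈ F <;> by_cases h3 : F ∈ H <;>
      by_cases h4 : swapSet i j F ∈ H <;> simp_all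

theorem codegree_eq_sum {n : ℕ} (H : Finset (Finset (Fin n))) (E : Finset (Fin n)) :
    codegree H E = ∑ F : Finset (Fin n), if E ⊆ F then (if F ∈ H then 1 else 0) else 0 := by
  simp only [← ite_and, ← Finset.card_filter]
  unfold codegree
  congr 1
  ext F
  simp [and_comm]

theorem codegree_swapSet {n : ℕ} (i j : Fin n) (H : Finset (Finset (Fin n)))
    (E : Finset (Fin n)) :
    codegree H (swapSet i j E) = ∑ F : Finset (Fin n),
      if E ⊆ F then (if swapSet i j F ∈ H then 1 else 0) else 0 := by
  rw [codegree_eq_sum, ← Equiv.sum_comp (swapPerm i j)]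
  refine Finset.sum_congr rfl fun F _ => ?_
  change (if swapSet i j E ⊆ swapSet i j F then _ else _) = _
  simp only [swapSet_subset_iff]
  rfl

/-- A shift only moves codegree between `E` and its mirror image. -/
theorem codegree_shift_add {n : ℕ} (i j : Fin n) (H : Finset (Finset (Fin n)))
    (E : Finset (Fin n)) :
    codegree (shift i j H) E + codegree (shift i j H) (swapSet i j E)
      = codegree H E + codegree H (swapSet i j E) := by
  simp only [codegree_swapSet]
  simp only [codegree_eq_sum, ← Finset.sum_add_distrib]
  refine Finset.sum_congr rfl fun F _ => ?_
  by_cases h : E ⊆ F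
  · simp only [if_pos h]
    exact shift_indicator i j H F
  · simp only [if_neg h]

theorem codegree_le_shift {n : ℕ} {i j : Fin n} (H : Finset (Finset (Fin n)))
    {E : Finset (Fin n)} (hi : i ∈ E) :
    codegree H E ≤ codegree (shift i j H) E ∧
      codegree H (swapSet i j E) ≤ codegree (shift i j H) E := by
  rw [codegree_swapSet]
  simp only [codegree_eq_sum]
  constructor <;> refine Finset.sum_le_sum fun F _ => ?_ <;> by_cases h : E ⊆ F <;>
    by_cases h1 : F ∈ H <;> by_cases h2 : swapSet i j F ∈ H <;>
    simp [mem_shift, h, h1, h2, fun h : E ⊆ F => h hi]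

/-- Truncated sums of codegrees do not decrease under shifting, since the codegrees of `E` and its
mirror image move apart while keeping their sum. -/
theorem codegree_shift_sub_add {n : ℕ} (i j : Fin n) (H : Finset (Finset (Fin n)))
    (E : Finset (Fin n)) (s : ℕ) :
    (codegree H E - s) + (codegree H (swapSet i j E) - s) ≤
      (codegree (shift i j H) E - s) + (codegree (shift i j H) (swapSet i j E) - s) := by
  have h := codegree_shift_add i j H E
  by_cases hi : i ∈ E
  · have := codegree_le_shift (j := j) H hi
    omega
  by_cases hj : j ∈ E
  · have hi' : i ∈ swapSet i j E := by rwa [mem_swapSet, Equiv.swap_apply_left]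
    have := codegree_le_shift (j := j) H hi'
    rw [swapSet_swapSet] at this
    omega
  · have : swapSet i j E = E := swapSet_eq_self (by tauto)
    rw [this] at h ⊢
    omega

/-- The sum over all pairs of vertices of the excess of the codegree over `s`. -/
def excess {n : ℕ} (s : ℕ) (H : Finset (Finset (Fin n))) : ℕ :=
  ∑ E ∈ Finset.powersetCard 2 (Finset.univ : Finset (Fin n)), (codegree H E - s)

theorem sum_swapSet {n : ℕ} (i j : Fin n) (k : ℕ) (f : Finset (Fin n) → ℕ) :
    ∑ E ∈ Finset.powersetCard k (Finset.univ : Finset (Fin n)), f (swapSet i j E)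
      = ∑ E ∈ Finset.powersetCard k (Finset.univ : Finset (Fin n)), f E := by
  refine Finset.sum_nbij' (swapSet i j) (swapSet i j) ?_ ?_ ?_ ?_ ?_ <;>
    simp [card_swapSet, swapSet_swapSet]

theorem excess_le_shift {n : ℕ} (i j : Fin n) (s : ℕ) (H : Finset (Finset (Fin n))) :
    excess s H ≤ excess s (shift i j H) := by
  have h := Finset.sum_le_sum fun E (_ : E ∈ Finset.powersetCard 2 (Finset.univ : Finset (Fin n)))
    => codegree_shift_sub_add i j H E s
  rw [Finset.sum_add_distrib, Finset.sum_add_distrib,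
    sum_swapSet i j 2 fun E => codegree H E - s,
    sum_swapSet i j 2 fun E => codegree (shift i j H) E - s] at h
  unfold excess
  omega

theorem codegree_empty {n : ℕ} (H : Finset (Finset (Fin n))) : codegree H ∅ = H.card := by
  simp [codegree]

theorem card_shift {n : ℕ} (i j : Fin n) (H : Finset (Finset (Fin n))) :
    (shift i j H).card = H.card := by
  have h := codegree_shift_add i j H ∅
  have h0 : swapSet i j ∅ = ∅ := rfl
  rw [h0, codegree_empty, codegree_empty] at h
  omega

theorem shift_subset_powersetCard {n k : ℕ} {i j : Fin n} {H : Finset (Finset (Fin n))}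
    (hH : H ⊆ Finset.powersetCard k Finset.univ) :
    shift i j H ⊆ Finset.powersetCard k Finset.univ := by
  intro F hF
  have h1 : ∀ F ∈ H, F.card = k := fun F hF => (Finset.mem_powersetCard.1 (hH hF)).2
  rw [Finset.mem_powersetCard_univ]
  rw [mem_shift] at hF
  rcases hF with h | ⟨_, h | h⟩
  · exact h1 _ h.1
  · exact h1 _ h
  · rw [← card_swapSet i j]
    exact h1 _ h

/-- `H` has no `s + 1` pairwise disjoint members, the members being listed by an indexing type. -/
def MatchingFree {n : ℕ} (s : ℕ) (H : Finset (Finset (Fin n))) : Prop :=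
  ∀ f : Fin (s + 1) → Finset (Fin n), (∀ a, f a ∈ H) → ∃ a b, a ≠ b ∧ ¬ Disjoint (f a) (f b)

theorem MatchingFree.not_pairwise {n s : ℕ} {H : Finset (Finset (Fin n))} (h : MatchingFree s H)
    {ι : Type*} [Fintype ι] (hι : Fintype.card ι = s + 1) (f : ι → Finset (Fin n))
    (hf : ∀ a, f a ∈ H) (hd : ∀ a b, a ≠ b → Disjoint (f a) (f b)) : False := by
  obtain ⟨a, b, hab, hn⟩ := h (fun k => f ((Fintype.equivFinOfCardEq hι).symm k)) fun _ => hf _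
  exact hn (hd _ _ fun h => hab ((Equiv.injective _) h))

theorem matchingFree_of_matchingNumber_le {n s : ℕ} {H : Finset (Finset (Fin n))}
    (hne : ∀ F ∈ H, F.Nonempty) (h : matchingNumber H ≤ s) : MatchingFree s H := by
  classical
  intro f hf
  by_contra! hd
  have hinj : Function.Injective f := by
    intro a b hab
    by_contra hne'
    have := hd a b hne'
    rw [hab, disjoint_self] at this
    exact (hne _ (hf b)).ne_empty this
  have hM : IsMatchingIn H (Finset.univ.image f) := by
    refine ⟨by simpa [Finset.image_subset_iff] using hf, ?_⟩
    intro A hA B hB hAB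
    simp only [Finset.coe_image, Finset.coe_univ, Set.image_univ, Set.mem_range] at hA hB
    obtain ⟨a, rfl⟩ := hA
    obtain ⟨b, rfl⟩ := hB
    exact hd a b fun h => hAB (by rw [h])
  have hle : (Finset.univ.image f).card ≤ matchingNumber H := by
    unfold matchingNumber
    exact Finset.le_sup (f := Finset.card) (by simp only [Finset.mem_filter, Finset.mem_powerset]; exact ⟨hM.1, hM⟩)
  rw [Finset.card_image_of_injective _ hinj, Finset.card_fin] at hle
  omega

/-- Shifting creates no larger matchings: at most one member of a matching in the shifted family
contains `i`, and if that one is not in `H`, then all the mirror images are. -/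
theorem MatchingFree.shifted {n s : ℕ} {H : Finset (Finset (Fin n))} (h : MatchingFree s H)
    (i j : Fin n) : MatchingFree s (shift i j H) := by
  intro f hf
  by_contra! hd
  have key : ∀ a, i ∉ f a → f a ∈ H ∧ swapSet i j (f a) ∈ H := fun a ha => by
    have := mem_shift.1 (hf a)
    tauto
  by_cases hall : ∀ a, f a ∈ H
  · obtain ⟨a, b, hab, hn⟩ := h f hall
    exact hn (hd a b hab)
  push Not at hall
  obtain ⟨a₀, ha₀⟩ := hall
  have hi : i ∈ f a₀ := by
    by_contra hi
    exact ha₀ (key a₀ hi).1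
  obtain ⟨a, b, hab, hn⟩ := h (fun a => swapSet i j (f a)) fun a => by
    by_cases ha : a = a₀
    · subst ha
      have := mem_shift.1 (hf a)
      tauto
    · exact (key a fun hia => (Finset.disjoint_left.1 (hd a a₀ ha) hia) hi).2
  exact hn ((Finset.disjoint_image (Equiv.injective _)).2 (hd a b hab))

/-- The sum of all entries of all members, a potential that decreases under shifting. -/
def weight {n : ℕ} (H : Finset (Finset (Fin n))) : ℕ := ∑ F ∈ H, ∑ x ∈ F, (x : ℕ)

theorem sum_lt_sum_swapSet {n : ℕ} {i j : Fin n} (hij : i < j) {F : Finset (Fin n)}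
    (hi : i ∈ F) (hj : j ∉ F) : ∑ x ∈ F, (x : ℕ) < ∑ x ∈ swapSet i j F, (x : ℕ) := by
  unfold swapSet
  rw [Finset.sum_image fun _ _ _ _ h => (Equiv.injective _) h]
  refine Finset.sum_lt_sum (fun x hx => ?_) ⟨i, hi, by simpa using hij⟩
  rcases eq_or_ne x i with rfl | hxi
  · simpa using hij.le
  · rw [Equiv.swap_apply_of_ne_of_ne hxi (by rintro rfl; exact hj hx)]

theorem weight_shift_lt {n : ℕ} {i j : Fin n} (hij : i < j) {H : Finset (Finset (Fin n))}
    (hne : shift i j H ≠ H) : weight (shift i j H) < weight H := by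
  have hw : ∀ K : Finset (Finset (Fin n)), 2 * weight K = ∑ F : Finset (Fin n),
      ((if F ∈ K then ∑ x ∈ F, (x : ℕ) else 0) +
        (if swapSet i j F ∈ K then ∑ x ∈ swapSet i j F, (x : ℕ) else 0)) := by
    intro K
    have h := Equiv.sum_comp (swapPerm i j) fun F => if F ∈ K then ∑ x ∈ F, (x : ℕ) else 0
    change ∑ F : Finset (Fin n),
      (if swapSet i j F ∈ K then ∑ x ∈ swapSet i j F, (x : ℕ) else 0) = _ at h
    rw [Finset.sum_add_distrib, h]
    simp [weight, two_mul]
  have hle : ∀ F : Finset (Fin n), ((if F ∈ shift i j H then ∑ x ∈ F, (x : ℕ) else 0) +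
        (if swapSet i j F ∈ shift i j H then ∑ x ∈ swapSet i j F, (x : ℕ) else 0)) ≤
      ((if F ∈ H then ∑ x ∈ F, (x : ℕ) else 0) +
        (if swapSet i j F ∈ H then ∑ x ∈ swapSet i j F, (x : ℕ) else 0)) ∧
      (F ∈ shift i j H → F ∉ H →
        ((if F ∈ shift i j H then ∑ x ∈ F, (x : ℕ) else 0) +
        (if swapSet i j F ∈ shift i j H then ∑ x ∈ swapSet i j F, (x : ℕ) else 0)) <
      ((if F ∈ H then ∑ x ∈ F, (x : ℕ) else 0) +
        (if swapSet i j F ∈ H then ∑ x ∈ swapSet i j F, (x : ℕ) else 0))) := by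
    intro F
    by_cases hF : i ∈ F ↔ j ∈ F
    · have : F ∈ shift i j H ↔ F ∈ H := by
        simp only [mem_shift, swapSet_eq_self hF]
        tauto
      rw [swapSet_eq_self hF]
      simp only [this]
      exact ⟨le_rfl, fun h h' => absurd h h'⟩
    · by_cases hi : i ∈ F
      · have hj : j ∉ F := by tauto
        have := sum_lt_sum_swapSet hij hi hj
        simp only [mem_shift, swapSet_swapSet, mem_swapSet, Equiv.swap_apply_left, hi, hj]
        by_cases h3 : F ∈ H <;> by_cases h4 : swapSet i j F ∈ H <;> simp [h3, h4] <;> omega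
      · have hj : j ∈ F := by tauto
        have := sum_lt_sum_swapSet hij (F := swapSet i j F)
          (by rwa [mem_swapSet, Equiv.swap_apply_left])
          (by rwa [mem_swapSet, Equiv.swap_apply_right])
        rw [swapSet_swapSet] at this
        simp only [mem_shift, swapSet_swapSet, mem_swapSet, Equiv.swap_apply_left, hi, hj]
        by_cases h3 : F ∈ H <;> by_cases h4 : swapSet i j F ∈ H <;> simp [h3, h4] <;> omega
  obtain ⟨F, hF, hF'⟩ : ∃ F ∈ shift i j H, F ∉ H := by
    by_contra! hsub
    exact hne (Finset.eq_of_subset_of_card_le hsub (card_shift i j H).ge)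
  have := Finset.sum_lt_sum (s := Finset.univ) (fun F _ => (hle F).1)
    ⟨F, Finset.mem_univ _, (hle F).2 hF hF'⟩
  rw [← hw, ← hw] at this
  omega

/-- A family that is fixed by all shifts towards smaller vertices. -/
def IsShifted {n : ℕ} (H : Finset (Finset (Fin n))) : Prop :=
  ∀ i j : Fin n, i < j → shift i j H = H

theorem IsShifted.swapSet_mem {n : ℕ} {H : Finset (Finset (Fin n))} (h : IsShifted H)
    {i j : Fin n} (hij : i < j) {F : Finset (Fin n)} (hF : F ∈ H) (hj : j ∈ F) :
    swapSet i j F ∈ H := by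
  rw [← h i j hij, mem_shift, swapSet_swapSet, mem_swapSet, Equiv.swap_apply_left]
  exact Or.inr ⟨hj, Or.inr hF⟩

/-! ### Nested families of pairs without a rainbow matching -/

/-- Greedy choice: if `B j` is larger than what `j` earlier choices can block, then members of the
`B j` without conflicts can be selected. -/
theorem exists_conflict_free {β : Type*} [DecidableEq β] (s : ℕ) (B : ℕ → Finset β)
    (r : β → β → Prop) [DecidableRel r] (X : Finset β) (hX : ∀ j ≤ s, B j ⊆ X)
    (hr : ∀ p ∈ X, (X.filter (r p)).card ≤ 2) (hB : ∀ j ≤ s, 2 * j < (B j).card) :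
    ∃ f : ℕ → β, ∀ j ≤ s, f j ∈ B j ∧ ∀ j' < j, ¬ r (f j') (f j) := by
  have key : ∀ k ≤ s + 1, ∃ f : ℕ → β, ∀ j < k, f j ∈ B j ∧ ∀ j' < j, ¬ r (f j') (f j) := by
    intro k
    induction k with
    | zero =>
      intro _
      obtain ⟨b, _⟩ := Finset.card_pos.1 (lt_of_le_of_lt (Nat.zero_le _) (hB 0 (Nat.zero_le _)))
      exact ⟨fun _ => b, fun j hj => absurd hj (Nat.not_lt_zero _)⟩
    | succ k ih =>
      intro hk
      obtain ⟨f, hf⟩ := ih (by omega)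
      have hblocked : ((Finset.range k).biUnion fun j => X.filter (r (f j))).card ≤ k * 2 := by
        have := Finset.card_biUnion_le_card_mul (Finset.range k) (fun j => X.filter (r (f j))) 2
          fun j hj => hr _ (hX j (by have := Finset.mem_range.1 hj; omega)
            (hf j (Finset.mem_range.1 hj)).1)
        simpa using this
      have hBk := hB k (by omega)
      obtain ⟨b, hb, hb'⟩ := Finset.exists_mem_notMem_of_card_lt_card
        (lt_of_le_of_lt hblocked (by omega : k * 2 < (B k).card))
      refine ⟨Function.update f k b, fun j hj => ?_⟩
      rcases Nat.lt_succ_iff_lt_or_eq.1 hj with hj | rfl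
      · rw [Function.update_of_ne hj.ne]
        refine ⟨(hf j hj).1, fun j' hj' => ?_⟩
        rw [Function.update_of_ne (hj'.trans hj).ne]
        exact (hf j hj).2 j' hj'
      · rw [Function.update_self]
        refine ⟨hb, fun j' hj' hr' => hb' ?_⟩
        rw [Function.update_of_ne hj'.ne] at hr'
        exact Finset.mem_biUnion.2 ⟨j', Finset.mem_range.2 hj',
          Finset.mem_filter.2 ⟨hX j (by omega) hb, hr'⟩⟩
  obtain ⟨f, hf⟩ := key (s + 1) le_rfl
  exact ⟨f, fun j hj => hf j (by omega)⟩

/-- The bound for nested subsets of a single class `X` of pairs, in which every member conflicts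
with at most two members. -/
theorem sum_card_le_of_nested {β : Type*} [DecidableEq β] (s w : ℕ) (A : ℕ → Finset β)
    (r : β → β → Prop) [DecidableRel r] (X : Finset β) (hAX : ∀ i ≤ s, A i ⊆ X)
    (hA : ∀ i j, i ≤ j → j ≤ s → A j ⊆ A i)
    (hr : ∀ p ∈ X, (X.filter (r p)).card ≤ 2) (hcard : 2 * (s + w) ≤ X.card)
    (hfree : ∀ f : ℕ → β, (∀ i ≤ s, f i ∈ A i) → ∃ i ≤ s, ∃ j ≤ s, i < j ∧ r (f j) (f i)) :
    ∑ i ∈ Finset.range s, (A i).card + w * (A s).card ≤ s * X.card := by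
  obtain ⟨i, his, hi⟩ : ∃ i ≤ s, (A i).card ≤ 2 * (s - i) := by
    by_contra! h
    obtain ⟨f, hf⟩ := exists_conflict_free s (fun j => A (s - j)) r X
      (fun j _ => hAX _ (Nat.sub_le _ _)) hr fun j hj => by
        have := h (s - j) (Nat.sub_le _ _)
        rwa [Nat.sub_sub_self hj] at this
    obtain ⟨i, hi, j, hj, hij, hc⟩ := hfree (fun i => f (s - i)) fun i hi => by
      have := (hf (s - i) (Nat.sub_le _ _)).1
      rwa [Nat.sub_sub_self hi] at this
    exact (hf (s - i) (Nat.sub_le _ _)).2 (s - j) (by omega) hc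
  obtain ⟨t, rfl⟩ := Nat.exists_eq_add_of_le his
  have h1 : ∑ k ∈ Finset.range i, (A k).card ≤ i * X.card := by
    have := Finset.sum_le_card_nsmul (Finset.range i) (fun k => (A k).card) X.card fun k hk =>
      Finset.card_le_card (hAX k (by have := Finset.mem_range.1 hk; omega))
    simpa using this
  have h2 : ∑ k ∈ Finset.range t, (A (i + k)).card ≤ t * (2 * t) := by
    have := Finset.sum_le_card_nsmul (Finset.range t) (fun k => (A (i + k)).card) (2 * t)
      fun k hk => by
        have hk := Finset.mem_range.1 hk
        have := Finset.card_le_card (hA i (i + k) (by omega) (by omega))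
        omega
    simpa using this
  have h3 : (A (i + t)).card ≤ 2 * t := by
    have := Finset.card_le_card (hA i (i + t) (by omega) le_rfl)
    omega
  have h4 : w * (A (i + t)).card ≤ w * (2 * t) := Nat.mul_le_mul_left _ h3
  have h5 : t * (2 * (i + t + w)) ≤ t * X.card := Nat.mul_le_mul_left _ hcard
  rw [Finset.sum_range_add, add_mul]
  nlinarith [Nat.zero_le (t * i)]

/-- The vertices with value at least `a`. -/
def upper (n a : ℕ) : Finset (Fin n) := Finset.univ.filter fun v => a ≤ (v : ℕ)

theorem mem_upper {n a : ℕ} {v : Fin n} : v ∈ upper n a ↔ a ≤ (v : ℕ) := by simp [upper]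

theorem card_upper {n a : ℕ} : (upper n a).card = n - a := by
  have h : (upper n a).card = ((Finset.range n).filter fun v => a ≤ v).card := by
    rw [upper, Finset.card_filter, Finset.card_filter, Finset.sum_range]
  rw [h]
  have : (Finset.range n).filter (fun v => a ≤ v) = Finset.Ico a n := by
    ext v
    simp [and_comm]
  rw [this, Nat.card_Ico]

/-- The ordered pairs of distinct vertices of value at least `a` whose sum lies in a given residue
class modulo `n - a`. Two pairs in the same class are equal, mirror images of each other, or
disjoint, so that the class is a near-perfect matching of the vertices. -/
def sumClass (n a c : ℕ) : Finset (Fin n × Fin n) :=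
  (upper n a).offDiag.filter fun q => ((q.1 : ℕ) + q.2) % (n - a) = c

theorem eq_of_mod_eq {n a x y z : ℕ} (hy : a ≤ y) (hyn : y < n) (hz : a ≤ z) (hzn : z < n)
    (h : (x + y) % (n - a) = (x + z) % (n - a)) : y = z := by
  have h1 : y ≡ z [MOD n - a] := Nat.ModEq.add_left_cancel' x h
  have h2 : a + (y - a) ≡ a + (z - a) [MOD n - a] := by
    rwa [Nat.add_sub_cancel' hy, Nat.add_sub_cancel' hz]
  have h3 := Nat.ModEq.eq_of_lt_of_lt (Nat.ModEq.add_left_cancel' a h2) (by omega) (by omega)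
  omega

/-- Sharing a vertex, as a relation on ordered pairs. -/
def Meets {n : ℕ} (p q : Fin n × Fin n) : Prop :=
  p.1 = q.1 ∨ p.1 = q.2 ∨ p.2 = q.1 ∨ p.2 = q.2

instance {n : ℕ} : DecidableRel (Meets (n := n)) := fun p q =>
  inferInstanceAs (Decidable (p.1 = q.1 ∨ p.1 = q.2 ∨ p.2 = q.1 ∨ p.2 = q.2))

theorem card_meets_le {n a c : ℕ} (p : Fin n × Fin n) (hp : p ∈ sumClass n a c) :
    ((sumClass n a c).filter (Meets p)).card ≤ 2 := by
  refine (Finset.card_le_card (t := {p, p.swap}) fun q hq => ?_).trans Finset.card_le_two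
  obtain ⟨x, y⟩ := p
  obtain ⟨u, v⟩ := q
  simp only [sumClass, Finset.mem_filter, Finset.mem_offDiag, mem_upper, Meets] at hp hq
  obtain ⟨⟨hx, hy, hxy⟩, hc⟩ := hp
  obtain ⟨⟨⟨hu, hv, huv⟩, hc'⟩, h⟩ := hq
  have hsum : ((x : ℕ) + y) % (n - a) = ((u : ℕ) + v) % (n - a) := hc.trans hc'.symm
  simp only [Finset.mem_insert, Finset.mem_singleton, Prod.mk.injEq, Prod.swap_prod_mk]
  rcases h with rfl | rfl | rfl | rfl
  · exact Or.inl ⟨rfl, (Fin.ext (eq_of_mod_eq hy y.2 hv v.2 hsum)).symm⟩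
  · rw [add_comm (u : ℕ)] at hsum
    exact Or.inr ⟨(Fin.ext (eq_of_mod_eq hy y.2 hu u.2 hsum)).symm, rfl⟩
  · rw [add_comm (x : ℕ)] at hsum
    exact Or.inr ⟨rfl, (Fin.ext (eq_of_mod_eq hx x.2 hv v.2 hsum)).symm⟩
  · rw [add_comm (x : ℕ), add_comm (u : ℕ)] at hsum
    exact Or.inl ⟨(Fin.ext (eq_of_mod_eq hx x.2 hu u.2 hsum)).symm, rfl⟩

theorem card_sumClass {n a c : ℕ} (hc : c < n - a) : n - a - 2 ≤ (sumClass n a c).card := by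
  set m := n - a with hm
  have hm0 : 0 < m := by omega
  -- vertices that are paired with themselves
  have hfix : ((upper n a).filter fun x : Fin n => ((x : ℕ) + x) % m = c).card ≤ 2 := by
    have : ((upper n a).filter fun x : Fin n => ((x : ℕ) + x) % m = c).card ≤ (Finset.range 2).card := by
      refine Finset.card_le_card_of_injOn (fun x : Fin n => (2 * ((x : ℕ) - a)) / m) ?_ ?_
      · intro x hx
        simp only [Finset.coe_range, Set.mem_Iio]
        rw [Nat.div_lt_iff_lt_mul hm0]
        have := x.2
        omega
      · intro x hx y hy hxy
        simp only [Finset.coe_filter, Set.mem_ofPred_eq, mem_upper] at hx hy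
        have h1 : 2 * a + 2 * ((x : ℕ) - a) ≡ 2 * a + 2 * ((y : ℕ) - a) [MOD m] := by
          have e1 : 2 * a + 2 * ((x : ℕ) - a) = (x : ℕ) + x := by omega
          have e2 : 2 * a + 2 * ((y : ℕ) - a) = (y : ℕ) + y := by omega
          rw [e1, e2]
          exact hx.2.trans hy.2.symm
        have h2 : (2 * ((x : ℕ) - a)) % m = (2 * ((y : ℕ) - a)) % m :=
          Nat.ModEq.add_left_cancel' _ h1
        have h3 := Nat.div_add_mod (2 * ((x : ℕ) - a)) m
        have h4 := Nat.div_add_mod (2 * ((y : ℕ) - a)) m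
        simp only at hxy
        rw [hxy, h2] at h3
        apply Fin.ext
        omega
    simpa using this
  have hle : ((upper n a).filter fun x : Fin n => ¬ ((x : ℕ) + x) % m = c).card
      ≤ (sumClass n a c).card := by
    have hlt : ∀ x : Fin n, a + (c + n * m - x - a) % m < n := fun x => by
      have := Nat.mod_lt (c + n * m - x - a) hm0
      omega
    refine Finset.card_le_card_of_injOn (fun x : Fin n => (x, ⟨_, hlt x⟩)) ?_ ?_
    · intro x hx
      simp only [Finset.coe_filter, Set.mem_ofPred_eq, mem_upper] at hx
      have hmod : ((x : ℕ) + (a + (c + n * m - x - a) % m)) % m = c := by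
        have hnm : (x : ℕ) + a ≤ n * m := by
          rcases Nat.lt_or_ge 1 m with h | h
          · have := x.2
            have : n * 2 ≤ n * m := Nat.mul_le_mul_left _ h
            omega
          · exfalso
            have hm1 : m = 1 := by omega
            rw [hm1] at hx hc
            omega
        rw [← add_assoc, Nat.add_mod_mod]
        have : (x : ℕ) + a + (c + n * m - x - a) = c + n * m := by omega
        rw [this, Nat.add_mul_mod_self_right, Nat.mod_eq_of_lt hc]
      simp only [sumClass, Finset.coe_filter, Set.mem_ofPred_eq, Finset.mem_offDiag, mem_upper]
      refine ⟨⟨hx.1, by omega, fun h => hx.2 ?_⟩, hmod⟩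
      have h' := congrArg Fin.val h
      simp only at h'
      rwa [← h'] at hmod
    · intro x _ y _ h
      exact congrArg Prod.fst h
  have hsum := Finset.card_filter_add_card_filter_not (s := upper n a)
    (fun x : Fin n => ((x : ℕ) + x) % m = c)
  rw [card_upper] at hsum
  omega

/-- Nested sets `A 0 ⊇ … ⊇ A s` of pairs that admit no choice of pairwise disjoint members
satisfy a weighted bound, obtained by summation over the classes `sumClass`. -/
theorem sum_card_le_of_nested_offDiag {n a s w : ℕ} (hn : 2 * (s + w) + 2 ≤ n - a)
    (A : ℕ → Finset (Fin n × Fin n)) (hAX : ∀ i ≤ s, A i ⊆ (upper n a).offDiag)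
    (hA : ∀ i j, i ≤ j → j ≤ s → A j ⊆ A i)
    (hfree : ∀ f : ℕ → Fin n × Fin n, (∀ i ≤ s, f i ∈ A i) →
      ∃ i ≤ s, ∃ j ≤ s, i < j ∧ Meets (f j) (f i)) :
    ∑ i ∈ Finset.range s, (A i).card + w * (A s).card ≤ s * ((n - a) * (n - a - 1)) := by
  have hm : 0 < n - a := by omega
  have hmaps : ∀ Y : Finset (Fin n × Fin n), Y.card = ∑ c ∈ Finset.range (n - a),
      (Y.filter fun q => ((q.1 : ℕ) + q.2) % (n - a) = c).card := fun Y =>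
    Finset.card_eq_sum_card_fiberwise fun q _ =>
      Finset.mem_coe.2 (Finset.mem_range.2 (Nat.mod_lt _ hm))
  have hoff : (n - a) * (n - a - 1) = ∑ c ∈ Finset.range (n - a), (sumClass n a c).card := by
    have h := hmaps (upper n a).offDiag
    rw [Finset.offDiag_card, card_upper, ← Nat.mul_sub_one] at h
    exact h
  have hclass : ∀ c ∈ Finset.range (n - a),
      ∑ i ∈ Finset.range s, ((A i).filter fun q => ((q.1 : ℕ) + q.2) % (n - a) = c).card +
        w * ((A s).filter fun q => ((q.1 : ℕ) + q.2) % (n - a) = c).card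
      ≤ s * (sumClass n a c).card := by
    intro c hc
    have hcard := card_sumClass (Finset.mem_range.1 hc)
    have h1 : ∀ i ≤ s, ((A i).filter fun q => ((q.1 : ℕ) + q.2) % (n - a) = c) ⊆
        sumClass n a c := fun i hi => Finset.filter_subset_filter _ (hAX i hi)
    have h2 : ∀ i j, i ≤ j → j ≤ s → ((A j).filter fun q => ((q.1 : ℕ) + q.2) % (n - a) = c) ⊆
        ((A i).filter fun q => ((q.1 : ℕ) + q.2) % (n - a) = c) :=
      fun i j hij hj => Finset.filter_subset_filter _ (hA i j hij hj)
    have h3 : 2 * (s + w) ≤ (sumClass n a c).card := by omega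
    refine sum_card_le_of_nested s w _ Meets (sumClass n a c) h1 h2 card_meets_le h3 ?_
    intro f hf
    exact hfree f fun i hi => (Finset.mem_filter.1 (hf i hi)).1
  have h := Finset.sum_le_sum hclass
  rw [Finset.sum_add_distrib, Finset.sum_comm, ← Finset.mul_sum, ← Finset.mul_sum, ← hoff,
    ← hmaps (A s)] at h
  rwa [Finset.sum_congr rfl fun i _ => hmaps (A i)]

/-! ### Codegrees as sums over vertices -/

/-- The indicator of `{x, y, z} ∈ H`, a symmetric function of three vertices. -/
def tripleInd {n : ℕ} (H : Finset (Finset (Fin n))) (x y z : Fin n) : ℕ :=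
  if ({x, y, z} : Finset (Fin n)) ∈ H then 1 else 0

theorem tripleInd_le_one {n : ℕ} (H : Finset (Finset (Fin n))) (x y z : Fin n) :
    tripleInd H x y z ≤ 1 := by
  unfold tripleInd
  split_ifs <;> omega

theorem tripleInd_comm {n : ℕ} (H : Finset (Finset (Fin n))) (x y z : Fin n) :
    tripleInd H x y z = tripleInd H y x z := by
  rw [tripleInd, tripleInd, Finset.insert_comm]

theorem tripleInd_rotate {n : ℕ} (H : Finset (Finset (Fin n))) (x y z : Fin n) :
    tripleInd H x y z = tripleInd H z x y := by
  rw [tripleInd_comm H z, tripleInd, tripleInd, Finset.pair_comm]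

theorem ne_of_triple_mem {n : ℕ} {H : Finset (Finset (Fin n))}
    (hH : H ⊆ Finset.powersetCard 3 Finset.univ) {x y z : Fin n}
    (h : ({x, y, z} : Finset (Fin n)) ∈ H) : x ≠ y ∧ x ≠ z ∧ y ≠ z := by
  have hc := (Finset.mem_powersetCard.1 (hH h)).2
  refine ⟨?_, ?_, ?_⟩ <;> rintro rfl
  · have : ({x, x, z} : Finset (Fin n)).card ≤ 2 := by
      rw [Finset.insert_idem]; exact Finset.card_le_two
    omega
  · have : ({x, y, x} : Finset (Fin n)).card ≤ 2 := by
      rw [Finset.pair_comm, Finset.insert_idem]; exact Finset.card_le_two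
    omega
  · have : ({x, y, y} : Finset (Fin n)).card ≤ 2 := by
      rw [Finset.pair_eq_singleton]; exact Finset.card_le_two
    omega

theorem codegree_pair {n : ℕ} {H : Finset (Finset (Fin n))}
    (hH : H ⊆ Finset.powersetCard 3 Finset.univ) {x y : Fin n} (hxy : x ≠ y) :
    codegree H {x, y} = ∑ z, tripleInd H x y z := by
  unfold tripleInd
  rw [← Finset.card_filter, codegree]
  symm
  refine Finset.card_bij (fun z _ => {x, y, z}) ?_ ?_ ?_
  · intro z hz
    simp only [Finset.mem_filter, Finset.mem_univ, true_and] at hz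
    rw [Finset.mem_filter]
    refine ⟨hz, fun w hw => ?_⟩
    simp only [Finset.mem_insert, Finset.mem_singleton] at hw ⊢
    tauto
  · intro z hz w hw hzw
    simp only [Finset.mem_filter, Finset.mem_univ, true_and] at hz hw
    have hne := ne_of_triple_mem hH hz
    have : z ∈ ({x, y, w} : Finset (Fin n)) := hzw ▸ (by simp)
    simp only [Finset.mem_insert, Finset.mem_singleton] at this
    rcases this with h | h | h
    · exact absurd h.symm hne.2.1
    · exact absurd h.symm hne.2.2
    · exact h
  · intro F hF
    rw [Finset.mem_filter] at hF
    have hc := (Finset.mem_powersetCard.1 (hH hF.1)).2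
    have h1 : (F \ {x, y}).card = 1 := by
      rw [Finset.card_sdiff_of_subset hF.2, hc, Finset.card_pair hxy]
    obtain ⟨z, hz⟩ := Finset.card_eq_one.1 h1
    have hFz : ({x, y, z} : Finset (Fin n)) = F := by
      rw [← Finset.sdiff_union_of_subset hF.2, hz]
      ext w
      simp only [Finset.mem_insert, Finset.mem_singleton, Finset.mem_union]
      tauto
    exact ⟨z, by simp [hFz, hF.1], hFz⟩

theorem card_filter_ne_ne {n : ℕ} {x y : Fin n} (hxy : x ≠ y) :
    (Finset.univ.filter fun z : Fin n => z ≠ x ∧ z ≠ y).card = n - 2 := by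
  have : (Finset.univ.filter fun z : Fin n => z ≠ x ∧ z ≠ y) = Finset.univ \ {x, y} := by
    ext z
    simp
  rw [this, Finset.card_sdiff_of_subset (Finset.subset_univ _), Finset.card_pair hxy,
    Finset.card_univ, Fintype.card_fin]

theorem codegree_pair_le {n : ℕ} {H : Finset (Finset (Fin n))}
    (hH : H ⊆ Finset.powersetCard 3 Finset.univ) {x y : Fin n} (hxy : x ≠ y) :
    codegree H {x, y} ≤ n - 2 := by
  rw [codegree_pair hH hxy, ← card_filter_ne_ne hxy, Finset.card_filter]
  refine Finset.sum_le_sum fun z _ => ?_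
  unfold tripleInd
  by_cases h : ({x, y, z} : Finset (Fin n)) ∈ H
  · have := ne_of_triple_mem hH h
    simp [h, this.2.1.symm, this.2.2.symm]
  · simp [h]

theorem starFamily_subset (n k s : ℕ) :
    starFamily n k s ⊆ Finset.powersetCard k Finset.univ :=
  Finset.filter_subset _ _

theorem triple_mem_starFamily {n s : ℕ} {x y z : Fin n} :
    ({x, y, z} : Finset (Fin n)) ∈ starFamily n 3 s ↔
      (x ≠ y ∧ x ≠ z ∧ y ≠ z) ∧ ((x : ℕ) < s ∨ (y : ℕ) < s ∨ (z : ℕ) < s) := by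
  constructor
  · intro h
    refine ⟨ne_of_triple_mem (starFamily_subset n 3 s) h, ?_⟩
    simpa [starFamily] using (Finset.mem_filter.1 h).2
  · rintro ⟨⟨h1, h2, h3⟩, h⟩
    refine Finset.mem_filter.2 ⟨?_, by simpa using h⟩
    rw [Finset.mem_powersetCard_univ, Finset.card_eq_three]
    exact ⟨x, y, z, h1, h2, h3, rfl⟩

theorem card_filter_val_lt {n s : ℕ} (hs : s ≤ n) :
    (Finset.univ.filter fun z : Fin n => (z : ℕ) < s).card = s := by
  have h := Finset.card_filter_add_card_filter_not (s := (Finset.univ : Finset (Fin n)))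
    (fun z : Fin n => s ≤ (z : ℕ))
  have h' : (Finset.univ.filter fun z : Fin n => s ≤ (z : ℕ)).card = n - s := card_upper
  simp only [not_le, Finset.card_univ, Fintype.card_fin] at h
  omega

theorem codegree_starFamily {n s : ℕ} (hs : s ≤ n) {x y : Fin n} (hxy : x ≠ y) :
    codegree (starFamily n 3 s) {x, y} = if (x : ℕ) < s ∨ (y : ℕ) < s then n - 2 else s := by
  rw [codegree_pair (starFamily_subset n 3 s) hxy]
  unfold tripleInd
  rw [← Finset.card_filter]
  simp only [triple_mem_starFamily]
  split_ifs with h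
  · rw [← card_filter_ne_ne hxy]
    congr 1
    ext z
    simp only [Finset.mem_filter, Finset.mem_univ, true_and]
    constructor
    · rintro ⟨⟨_, h1, h2⟩, _⟩
      exact ⟨h1.symm, h2.symm⟩
    · rintro ⟨h1, h2⟩
      exact ⟨⟨hxy, h1.symm, h2.symm⟩, by tauto⟩
  · refine Eq.trans ?_ (card_filter_val_lt hs)
    congr 1
    ext z
    simp only [Finset.mem_filter, Finset.mem_univ, true_and]
    push Not at h
    constructor
    · rintro ⟨_, h1⟩
      omega
    · intro hz
      refine ⟨⟨hxy, ?_, ?_⟩, Or.inr (Or.inr hz)⟩ <;> rintro rfl <;> omega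

theorem two_mul_sum_pairs {n : ℕ} (φ : Finset (Fin n) → ℕ) :
    2 * ∑ E ∈ Finset.powersetCard 2 (Finset.univ : Finset (Fin n)), φ E
      = ∑ x, ∑ y, if x ≠ y then φ {x, y} else 0 := by
  rw [← Finset.sum_product' (f := fun x y => if x ≠ y then φ {x, y} else 0),
    ← Finset.sum_filter (s := Finset.univ ×ˢ Finset.univ)
      (p := fun q : Fin n × Fin n => q.1 ≠ q.2) (f := fun q => φ {q.1, q.2}),
    ← Finset.sum_fiberwise_of_maps_to (g := fun q : Fin n × Fin n => ({q.1, q.2} : Finset (Fin n)))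
      (t := Finset.powersetCard 2 Finset.univ), Finset.mul_sum]
  · refine Finset.sum_congr rfl fun E hE => ?_
    rw [Finset.mem_powersetCard_univ, Finset.card_eq_two] at hE
    obtain ⟨a, b, hab, rfl⟩ := hE
    have : ((Finset.univ ×ˢ Finset.univ).filter fun q : Fin n × Fin n => q.1 ≠ q.2).filter
        (fun q => ({q.1, q.2} : Finset (Fin n)) = {a, b}) = {(a, b), (b, a)} := by
      ext ⟨x, y⟩
      simp only [Finset.mem_filter, Finset.mem_product, Finset.mem_univ, true_and,
        Finset.mem_insert, Finset.mem_singleton, Prod.mk.injEq]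
      constructor
      · rintro ⟨hxy, h⟩
        have hx : x ∈ ({a, b} : Finset (Fin n)) := h ▸ (by simp)
        have hy : y ∈ ({a, b} : Finset (Fin n)) := h ▸ (by simp)
        simp only [Finset.mem_insert, Finset.mem_singleton] at hx hy
        rcases hx with rfl | rfl <;> rcases hy with rfl | rfl <;> simp_all
      · rintro (⟨rfl, rfl⟩ | ⟨rfl, rfl⟩)
        · exact ⟨hab, rfl⟩
        · exact ⟨hab.symm, Finset.pair_comm _ _⟩
    rw [this, Finset.sum_pair (by simp [hab]), Finset.pair_comm b a, two_mul]
  · rintro ⟨x, y⟩ hq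
    simp only [Finset.mem_filter, Finset.mem_product, Finset.mem_univ, true_and] at hq
    rw [Finset.mem_powersetCard_univ, Finset.card_pair hq]

/-- The vertices with value less than `a`. -/
def lower (n a : ℕ) : Finset (Fin n) := Finset.univ.filter fun v => (v : ℕ) < a

theorem mem_lower {n a : ℕ} {v : Fin n} : v ∈ lower n a ↔ (v : ℕ) < a := by simp [lower]

theorem sum_lower_add_sum_upper {n : ℕ} (a : ℕ) (f : Fin n → ℕ) :
    ∑ x, f x = ∑ x ∈ lower n a, f x + ∑ x ∈ upper n a, f x := by
  rw [← Finset.sum_filter_add_sum_filter_not Finset.univ fun x : Fin n => (x : ℕ) < a]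
  simp only [not_lt]
  rfl

theorem sum_sum_of_symm {n : ℕ} (a : ℕ) (f : Fin n → Fin n → ℕ) (hf : ∀ x y, f x y = f y x) :
    ∑ x, ∑ y, f x y = ∑ x ∈ lower n a, ∑ y ∈ lower n a, f x y
      + 2 * ∑ x ∈ lower n a, ∑ y ∈ upper n a, f x y
      + ∑ x ∈ upper n a, ∑ y ∈ upper n a, f x y := by
  rw [sum_lower_add_sum_upper a]
  simp only [fun x => sum_lower_add_sum_upper a (f x), Finset.sum_add_distrib]
  rw [Finset.sum_comm (s := upper n a) (t := lower n a)]

  have : ∑ y ∈ lower n a, ∑ x ∈ upper n a, f x y = ∑ x ∈ lower n a, ∑ y ∈ upper n a, f x y :=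
    Finset.sum_congr rfl fun x _ => Finset.sum_congr rfl fun y _ => hf y x
  omega

/-! ### Shifted families -/

theorem swapSet_triple {n : ℕ} {i j x y : Fin n} (hxi : x ≠ i) (hxj : x ≠ j) (hyi : y ≠ i)
    (hyj : y ≠ j) : swapSet i j {j, x, y} = {i, x, y} := by
  simp [swapSet, Finset.image_insert, Equiv.swap_apply_of_ne_of_ne, hxi, hxj, hyi, hyj]

/-- In a shifted family, a vertex of a triple may be replaced by a smaller one. -/
theorem IsShifted.replace {n : ℕ} {H : Finset (Finset (Fin n))} (h : IsShifted H)
    (hH : H ⊆ Finset.powersetCard 3 Finset.univ) {u x y z : Fin n}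
    (hx : ({x, y, z} : Finset (Fin n)) ∈ H) (hux : u ≤ x) (huy : u ≠ y) (huz : u ≠ z) :
    ({u, y, z} : Finset (Fin n)) ∈ H := by
  rcases hux.eq_or_lt with rfl | hlt
  · exact hx
  have hne := ne_of_triple_mem hH hx
  have := h.swapSet_mem hlt hx (by simp)
  rwa [swapSet_triple huy.symm hne.1.symm huz.symm hne.2.1.symm] at this

theorem triple_rotate {n : ℕ} (x y z : Fin n) : ({x, y, z} : Finset (Fin n)) = {y, z, x} := by
  ext w
  simp only [Finset.mem_insert, Finset.mem_singleton]
  tauto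

/-- A triple of a shifted family that is large enough in every entry dominates the `s + 1`
disjoint triples `{i, s + 1 + i, 2s + 2 + i}`. -/
theorem IsShifted.not_mem_of_large {n s : ℕ} {H : Finset (Finset (Fin n))} (h : IsShifted H)
    (hH : H ⊆ Finset.powersetCard 3 Finset.univ) (hfree : MatchingFree s H) (hn : 3 * s + 3 ≤ n)
    {x y z : Fin n} (hx : s ≤ (x : ℕ)) (hy : 2 * s + 1 ≤ (y : ℕ)) (hz : 3 * s + 2 ≤ (z : ℕ)) :
    ({x, y, z} : Finset (Fin n)) ∉ H := by
  intro hmem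
  refine hfree.not_pairwise (ι := Fin (s + 1)) (Fintype.card_fin _)
    (fun i => {⟨i, by omega⟩, ⟨s + 1 + i, by omega⟩, ⟨2 * s + 2 + i, by omega⟩}) ?_ ?_
  · intro i
    have hi := i.2
    have h1 : ({⟨i, by omega⟩, y, z} : Finset (Fin n)) ∈ H :=
      h.replace hH hmem (by rw [Fin.le_def]; simp only; omega)
        (by rw [Ne, Fin.ext_iff]; simp only; omega) (by rw [Ne, Fin.ext_iff]; simp only; omega)
    rw [triple_rotate] at h1
    have h2 : ({⟨s + 1 + i, by omega⟩, z, ⟨i, by omega⟩} : Finset (Fin n)) ∈ H :=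
      h.replace hH h1 (by rw [Fin.le_def]; simp only; omega)
        (by rw [Ne, Fin.ext_iff]; simp only; omega) (by rw [Ne, Fin.ext_iff]; simp only; omega)
    rw [triple_rotate] at h2
    have h3 := h.replace hH (u := ⟨2 * s + 2 + i, by omega⟩) h2
        (by rw [Fin.le_def]; simp only; omega)
        (by rw [Ne, Fin.ext_iff]; simp only; omega) (by rw [Ne, Fin.ext_iff]; simp only; omega)
    rw [triple_rotate] at h3
    exact h3
  · intro i j hij
    have hi := i.2
    have hj := j.2
    have hij' : (i : ℕ) ≠ j := fun h => hij (Fin.ext h)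
    rw [Finset.disjoint_left]
    intro v hv hv'
    simp only [Finset.mem_insert, Finset.mem_singleton, Fin.ext_iff] at hv hv'
    omega

/-- The pairs that extend vertex number `i` to a member of `H`, as ordered pairs of vertices of
value at least `a`. -/
def linkPairs {n : ℕ} (H : Finset (Finset (Fin n))) (a i : ℕ) : Finset (Fin n × Fin n) :=
  (upper n a).offDiag.filter fun q => ∃ u : Fin n, (u : ℕ) = i ∧ {u, q.1, q.2} ∈ H

theorem card_linkPairs {n : ℕ} {H : Finset (Finset (Fin n))}
    (hH : H ⊆ Finset.powersetCard 3 Finset.univ) (a : ℕ) (u : Fin n) :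
    (linkPairs H a u).card = ∑ x ∈ upper n a, ∑ y ∈ upper n a, tripleInd H u x y := by
  rw [← Finset.sum_product' (f := fun x y => tripleInd H u x y)]
  unfold tripleInd
  rw [← Finset.card_filter (fun q : Fin n × Fin n => ({u, q.1, q.2} : Finset (Fin n)) ∈ H)]
  congr 1
  ext ⟨x, y⟩
  simp only [linkPairs, Finset.mem_filter, Finset.mem_offDiag, Finset.mem_product]
  constructor
  · rintro ⟨⟨hx, hy, _⟩, v, hv, hm⟩
    rw [Fin.ext hv] at hm
    exact ⟨⟨hx, hy⟩, hm⟩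
  · rintro ⟨⟨hx, hy⟩, hm⟩
    exact ⟨⟨hx, hy, (ne_of_triple_mem hH hm).2.2⟩, u, rfl, hm⟩

theorem Meets.symm {n : ℕ} {p q : Fin n × Fin n} (h : Meets p q) : Meets q p := by
  unfold Meets at *
  rcases h with h | h | h | h <;> simp [h]

/-- The weighted bound for the links of the first `s + 1` vertices of a shifted family. -/
theorem IsShifted.sum_card_linkPairs_le {n s w : ℕ} {H : Finset (Finset (Fin n))}
    (h : IsShifted H) (hH : H ⊆ Finset.powersetCard 3 Finset.univ) (hfree : MatchingFree s H)
    (hn : 2 * (s + w) + 2 ≤ n - (s + 1)) :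
    ∑ i ∈ Finset.range s, (linkPairs H (s + 1) i).card + w * (linkPairs H (s + 1) s).card
      ≤ s * ((n - (s + 1)) * (n - (s + 1) - 1)) := by
  refine sum_card_le_of_nested_offDiag hn _ (fun i _ => Finset.filter_subset _ _) ?_ ?_
  · rintro i j hij hj ⟨x, y⟩ hq
    simp only [linkPairs, Finset.mem_filter, Finset.mem_offDiag, mem_upper] at hq ⊢
    obtain ⟨hxy, v, hv, hm⟩ := hq
    refine ⟨hxy, ⟨i, by omega⟩, rfl, h.replace hH hm (by rw [Fin.le_def]; simp only; omega) ?_ ?_⟩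
      <;> rw [Ne, Fin.ext_iff] <;> simp only <;> omega
  · intro f hf
    have hf' : ∀ i ≤ s, s + 1 ≤ ((f i).1 : ℕ) ∧ s + 1 ≤ ((f i).2 : ℕ) ∧
        ∃ u : Fin n, (u : ℕ) = i ∧ {u, (f i).1, (f i).2} ∈ H := fun i hi => by
      have := hf i hi
      simp only [linkPairs, Finset.mem_filter, Finset.mem_offDiag, mem_upper] at this
      exact ⟨this.1.1, this.1.2.1, this.2⟩
    have hlt : ∀ i : Fin (s + 1), (i : ℕ) < n := fun i => by omega
    obtain ⟨a, b, hab, hd⟩ := hfree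
      (fun i => {⟨i, hlt i⟩, (f i).1, (f i).2}) fun i => by
        obtain ⟨_, _, u, hu, hm⟩ := hf' i (by omega)
        have : u = ⟨i, hlt i⟩ := Fin.ext hu
        rwa [this] at hm
    have hab' : (a : ℕ) ≠ b := fun h => hab (Fin.ext h)
    have hm : Meets (f a) (f b) := by
      obtain ⟨v, hva, hvb⟩ := Finset.not_disjoint_iff.1 hd
      have h1 := hf' a (by omega)
      have h2 := hf' b (by omega)
      simp only [Finset.mem_insert, Finset.mem_singleton] at hva hvb
      unfold Meets
      rcases hva with rfl | rfl | rfl <;> rcases hvb with e | e | e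
      · exact absurd (congrArg Fin.val e) hab'
      · have : (a : ℕ) = (f b).1 := Fin.ext_iff.1 e
        omega
      · have : (a : ℕ) = (f b).2 := Fin.ext_iff.1 e
        omega
      · have : ((f a).1 : ℕ) = b := Fin.ext_iff.1 e
        omega
      · exact Or.inl e
      · exact Or.inr (Or.inl e)
      · have : ((f a).2 : ℕ) = b := Fin.ext_iff.1 e
        omega
      · exact Or.inr (Or.inr (Or.inl e))
      · exact Or.inr (Or.inr (Or.inr e))
    rcases Nat.lt_or_gt_of_ne hab' with hlt | hlt
    · exact ⟨a, by omega, b, by omega, hlt, hm.symm⟩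
    · exact ⟨b, by omega, a, by omega, hlt, hm⟩

theorem sum_rotate {α : Type*} (U : Finset α) (f : α → α → α → ℕ) :
    ∑ x ∈ U, ∑ y ∈ U, ∑ z ∈ U, f z x y = ∑ x ∈ U, ∑ y ∈ U, ∑ z ∈ U, f x y z := by
  rw [Finset.sum_congr rfl fun x _ => Finset.sum_comm, Finset.sum_comm]

/-- Whether `z` is counted as an extension of the pair `x, y` in the estimate of the triples of
large vertices. -/
def IsCounted {n : ℕ} (s : ℕ) (x y z : Fin n) : Prop :=
  z ≠ x ∧ (z : ℕ) ≤ 3 * s + 1 ∧ (3 * s + 2 ≤ (x : ℕ) ∨ 3 * s + 2 ≤ (y : ℕ) → (z : ℕ) ≤ 2 * s)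

open Classical in
theorem card_isCounted_le {n s : ℕ} (hs : 1 ≤ s) {x y : Fin n} (hx : x ∈ upper n (s + 1)) :
    ((upper n (s + 1)).filter (IsCounted s x y)).card ≤ 2 * s := by
  rw [mem_upper] at hx
  by_cases hbig : 3 * s + 2 ≤ (x : ℕ) ∨ 3 * s + 2 ≤ (y : ℕ)
  · have : ((upper n (s + 1)).filter (IsCounted s x y)).card ≤ (Finset.Icc (s + 1) (2 * s)).card := by
      refine Finset.card_le_card_of_injOn Fin.val (fun z hz => ?_) fun _ _ _ _ h => Fin.ext h
      simp only [Finset.coe_filter, Set.mem_ofPred_eq, mem_upper, IsCounted] at hz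
      simp only [Finset.coe_Icc, Set.mem_Icc]
      exact ⟨hz.1, hz.2.2.2 hbig⟩
    rw [Nat.card_Icc] at this
    omega
  · have : ((upper n (s + 1)).filter (IsCounted s x y)).card ≤
        ((Finset.Icc (s + 1) (3 * s + 1)).erase x).card := by
      refine Finset.card_le_card_of_injOn Fin.val (fun z hz => ?_) fun _ _ _ _ h => Fin.ext h
      simp only [Finset.coe_filter, Set.mem_ofPred_eq, mem_upper, IsCounted] at hz
      rw [Finset.mem_coe, Finset.mem_erase, Finset.mem_Icc]
      exact ⟨fun h => hz.2.1 (Fin.ext h), hz.1, hz.2.2.1⟩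
    rw [Finset.card_erase_of_mem (by rw [Finset.mem_Icc]; omega), Nat.card_Icc] at this
    omega

open Classical in
/-- The triples that avoid the first `s + 1` vertices are few compared to the pairs in the link of
vertex number `s`: in every such triple at least two vertices are counted as extensions of the pair
formed by the others, that pair lies in the link by shiftedness, and each pair has at most `2s`
counted extensions. -/
theorem IsShifted.sum_upper_le {n s : ℕ} (hs : 1 ≤ s) {H : Finset (Finset (Fin n))}
    (h : IsShifted H) (hH : H ⊆ Finset.powersetCard 3 Finset.univ) (hfree : MatchingFree s H)
    (hn : 3 * s + 3 ≤ n) {v : Fin n} (hv : (v : ℕ) = s) :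
    ∑ x ∈ upper n (s + 1), ∑ y ∈ upper n (s + 1), ∑ z ∈ upper n (s + 1), tripleInd H x y z
      ≤ 3 * s * ∑ x ∈ upper n (s + 1), ∑ y ∈ upper n (s + 1), tripleInd H v x y := by
  set U := upper n (s + 1) with hU
  set c : Fin n → Fin n → Fin n → ℕ := fun x y z =>
    tripleInd H v x y * if IsCounted s x y z then 1 else 0 with hc
  have hpoint : ∀ x ∈ U, ∀ y ∈ U, ∀ z ∈ U,
      2 * tripleInd H x y z ≤ c x y z + c y z x + c z x y := by
    intro x hx y hy z hz
    by_cases hm : ({x, y, z} : Finset (Fin n)) ∈ H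
    swap
    · simp [tripleInd, hm]
    simp only [hU, mem_upper] at hx hy hz
    have hm2 : ({y, z, x} : Finset (Fin n)) ∈ H := triple_rotate x y z ▸ hm
    have hm3 : ({z, x, y} : Finset (Fin n)) ∈ H := triple_rotate y z x ▸ hm2
    have hne := ne_of_triple_mem hH hm
    have hlink : ∀ x y z : Fin n, s + 1 ≤ (x : ℕ) → s + 1 ≤ (y : ℕ) → s + 1 ≤ (z : ℕ) →
        ({z, x, y} : Finset (Fin n)) ∈ H → tripleInd H v x y = 1 := by
      intro x y z hx hy hz hm
      refine if_pos (h.replace hH hm (by rw [Fin.le_def]; omega) ?_ ?_) <;>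
        rw [Ne, Fin.ext_iff] <;> omega
    have hlarge : ∀ x y z : Fin n, s + 1 ≤ (x : ℕ) → ({x, y, z} : Finset (Fin n)) ∈ H →
        3 * s + 2 ≤ (z : ℕ) → (y : ℕ) ≤ 2 * s := fun x y z hx hm hz => by
      by_contra hy
      exact h.not_mem_of_large hH hfree hn (by omega) (by omega) hz hm
    have hm4 : ({y, x, z} : Finset (Fin n)) ∈ H := Finset.insert_comm x y {z} ▸ hm
    have hm5 : ({x, z, y} : Finset (Fin n)) ∈ H := triple_rotate y x z ▸ hm4
    have hm6 : ({z, y, x} : Finset (Fin n)) ∈ H := triple_rotate x z y ▸ hm5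
    have a1 := hlarge x y z hx hm
    have a2 := hlarge y z x hy hm2
    have a3 := hlarge z x y hz hm3
    have a4 := hlarge y x z hy hm4
    have a5 := hlarge x z y hx hm5
    have a6 := hlarge z y x hz hm6
    have e1 : tripleInd H x y z = 1 := if_pos hm
    simp only [hc, hlink x y z hx hy hz hm3, hlink y z x hy hz hx hm, hlink z x y hz hx hy hm2, e1,
      one_mul]
    have g1 : (z : ℕ) ≤ 3 * s + 1 → IsCounted s x y z := fun hz' =>
      ⟨hne.2.1.symm, hz', fun hb => by omega⟩
    have g2 : (x : ℕ) ≤ 3 * s + 1 → IsCounted s y z x := fun hx' =>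
      ⟨hne.1, hx', fun hb => by omega⟩
    have g3 : (y : ℕ) ≤ 3 * s + 1 → IsCounted s z x y := fun hy' =>
      ⟨hne.2.2, hy', fun hb => by omega⟩
    have k1 : (if (z : ℕ) ≤ 3 * s + 1 then 1 else 0) ≤ if IsCounted s x y z then 1 else 0 := by
      split_ifs <;> simp_all
    have k2 : (if (x : ℕ) ≤ 3 * s + 1 then 1 else 0) ≤ if IsCounted s y z x then 1 else 0 := by
      split_ifs <;> simp_all
    have k3 : (if (y : ℕ) ≤ 3 * s + 1 then 1 else 0) ≤ if IsCounted s z x y then 1 else 0 := by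
      split_ifs <;> simp_all
    refine le_trans ?_ (add_le_add (add_le_add k1 k2) k3)
    split_ifs <;> omega
  have hsum := Finset.sum_le_sum fun x hx => Finset.sum_le_sum fun y hy =>
    Finset.sum_le_sum fun z hz => hpoint x hx y hy z hz
  simp only [Finset.sum_add_distrib, ← Finset.mul_sum] at hsum
  have r1 := sum_rotate U c
  have r2 := sum_rotate U fun x y z => c z x y
  have hcount : ∑ x ∈ U, ∑ y ∈ U, ∑ z ∈ U, c x y z
      ≤ 2 * s * ∑ x ∈ U, ∑ y ∈ U, tripleInd H v x y := by
    rw [Finset.mul_sum]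
    refine Finset.sum_le_sum fun x hx => ?_
    rw [Finset.mul_sum]
    refine Finset.sum_le_sum fun y _ => ?_
    simp only [hc]
    rw [← Finset.mul_sum, ← Finset.card_filter, mul_comm]
    exact Nat.mul_le_mul_right _ (card_isCounted_le hs hx)
  have r3 : 3 * (2 * s * ∑ x ∈ U, ∑ y ∈ U, tripleInd H v x y)
      = 2 * (3 * s * ∑ x ∈ U, ∑ y ∈ U, tripleInd H v x y) := by ring
  omega

/-! ### Comparison of a shifted family with the star -/

theorem card_lower {n a : ℕ} (ha : a ≤ n) : (lower n a).card = a := card_filter_val_lt ha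

/-- The excess over `t`, split according to how many vertices of a pair are among the first
`s + 1`. -/
theorem two_mul_excess {n : ℕ} (s t : ℕ) (H : Finset (Finset (Fin n))) :
    2 * excess t H =
      (∑ x ∈ lower n (s + 1), ∑ y ∈ lower n (s + 1), if x ≠ y then codegree H {x, y} - t else 0)
      + 2 * (∑ x ∈ lower n (s + 1), ∑ y ∈ upper n (s + 1), (codegree H {x, y} - t))
      + ∑ x ∈ upper n (s + 1), ∑ y ∈ upper n (s + 1), if x ≠ y then codegree H {x, y} - t else 0 := by
  unfold excess
  rw [two_mul_sum_pairs fun E => codegree H E - t, sum_sum_of_symm (s + 1)]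
  · congr 3
    refine Finset.sum_congr rfl fun x hx => Finset.sum_congr rfl fun y hy => ?_
    rw [mem_lower] at hx
    rw [mem_upper] at hy
    rw [if_pos]
    rintro rfl
    omega
  · intro x y
    rw [Finset.pair_comm]
    simp only [ne_comm]

theorem two_mul_excess_starFamily {n s t : ℕ} (hn : s + 1 ≤ n) :
    2 * excess t (starFamily n 3 s) =
      (∑ x ∈ lower n (s + 1), ∑ y ∈ lower n (s + 1),
        if x ≠ y then codegree (starFamily n 3 s) {x, y} - t else 0)
      + 2 * (s * ((n - (s + 1)) * (n - 2 - t)) + (n - (s + 1)) * (s - t))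
      + (n - (s + 1)) * (n - (s + 1) - 1) * (s - t) := by
  rw [two_mul_excess s]
  congr 1
  · congr 2
    have hins : lower n (s + 1) = insert ⟨s, by omega⟩ (lower n s) := by
      ext v
      simp only [mem_lower, Finset.mem_insert, Fin.ext_iff]
      omega
    rw [hins, Finset.sum_insert (by simp [mem_lower]), add_comm]
    congr 1
    · have : ∀ x ∈ lower n s, ∑ y ∈ upper n (s + 1), (codegree (starFamily n 3 s) {x, y} - t)
          = (n - (s + 1)) * (n - 2 - t) := by
        intro x hx
        rw [mem_lower] at hx
        rw [Finset.sum_congr rfl (g := fun _ => n - 2 - t), Finset.sum_const, card_upper,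
          smul_eq_mul]
        intro y hy
        rw [mem_upper] at hy
        rw [codegree_starFamily (by omega) (by rintro rfl; omega), if_pos (Or.inl hx)]
      rw [Finset.sum_congr rfl this, Finset.sum_const, card_lower (by omega), smul_eq_mul]
    · rw [Finset.sum_congr rfl (g := fun _ => s - t), Finset.sum_const, card_upper, smul_eq_mul]
      intro y hy
      rw [mem_upper] at hy
      rw [codegree_starFamily (by omega) (by rw [Ne, Fin.ext_iff]; simp only; omega), if_neg]
      simp only
      omega
  · rw [← Finset.sum_product' (f := fun x y =>
        if x ≠ y then codegree (starFamily n 3 s) {x, y} - t else 0)]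
    rw [← Finset.sum_filter (s := upper n (s + 1) ×ˢ upper n (s + 1))
      (p := fun q : Fin n × Fin n => q.1 ≠ q.2)
      (f := fun q => codegree (starFamily n 3 s) {q.1, q.2} - t)]
    have : (upper n (s + 1) ×ˢ upper n (s + 1)).filter (fun q : Fin n × Fin n => q.1 ≠ q.2)
        = (upper n (s + 1)).offDiag := by
      ext ⟨x, y⟩
      simp [and_assoc]
    rw [this, Finset.sum_congr rfl (g := fun _ => s - t), Finset.sum_const, Finset.offDiag_card,
      card_upper, smul_eq_mul, Nat.mul_sub_one]
    rintro ⟨x, y⟩ hq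
    rw [Finset.mem_offDiag, mem_upper, mem_upper] at hq
    rw [codegree_starFamily (by omega) hq.2.2, if_neg]
    simp only at hq ⊢
    omega

theorem sum_lower_codegree_le {n s t : ℕ} {H : Finset (Finset (Fin n))}
    (hH : H ⊆ Finset.powersetCard 3 Finset.univ) (hn : s + 1 ≤ n) :
    (∑ x ∈ lower n (s + 1), ∑ y ∈ lower n (s + 1), if x ≠ y then codegree H {x, y} - t else 0)
      ≤ ∑ x ∈ lower n (s + 1), ∑ y ∈ lower n (s + 1),
        if x ≠ y then codegree (starFamily n 3 s) {x, y} - t else 0 := by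
  refine Finset.sum_le_sum fun x hx => Finset.sum_le_sum fun y hy => ?_
  split_ifs with hxy
  · rw [mem_lower] at hx hy
    have hxy' : (x : ℕ) ≠ y := fun h => hxy (Fin.ext h)
    rw [codegree_starFamily (by omega) hxy, if_pos (by omega)]
    exact Nat.sub_le_sub_right (codegree_pair_le hH hxy) t
  · exact le_rfl

theorem sum_lower_upper_le {n s t : ℕ} {H : Finset (Finset (Fin n))}
    (hH : H ⊆ Finset.powersetCard 3 Finset.univ) (hn : s + 1 ≤ n) (ht : t ≤ s) :
    ∑ x ∈ lower n (s + 1), ∑ y ∈ upper n (s + 1), (codegree H {x, y} - t)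
      ≤ (s + 1) * ((n - (s + 1)) * (s - t)) + ∑ x ∈ lower n (s + 1), ∑ y ∈ upper n (s + 1),
        ∑ z ∈ upper n (s + 1), tripleInd H x y z := by
  have hconst : (s + 1) * ((n - (s + 1)) * (s - t))
      = ∑ x ∈ lower n (s + 1), ∑ y ∈ upper n (s + 1), (s - t) := by
    simp [card_lower hn, card_upper]
  rw [hconst, ← Finset.sum_add_distrib]
  refine Finset.sum_le_sum fun x hx => ?_
  rw [← Finset.sum_add_distrib]
  refine Finset.sum_le_sum fun y hy => ?_
  have hxy : x ≠ y := by
    rintro rfl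
    rw [mem_lower] at hx
    rw [mem_upper] at hy
    omega
  rw [codegree_pair hH hxy, sum_lower_add_sum_upper (s + 1)]
  have hle : ∑ z ∈ lower n (s + 1), tripleInd H x y z ≤ s := by
    rw [← Finset.add_sum_erase _ _ hx]
    have h0 : tripleInd H x y x = 0 := if_neg fun hm => (ne_of_triple_mem hH hm).2.1 rfl
    have h1 := Finset.sum_le_card_nsmul ((lower n (s + 1)).erase x) (fun z => tripleInd H x y z) 1
      fun z _ => tripleInd_le_one H x y z
    rw [Finset.card_erase_of_mem hx, card_lower hn, smul_eq_mul] at h1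
    omega
  omega

theorem sum_upper_le_zero {n s : ℕ} {H : Finset (Finset (Fin n))}
    (hH : H ⊆ Finset.powersetCard 3 Finset.univ) :
    (∑ x ∈ upper n (s + 1), ∑ y ∈ upper n (s + 1), if x ≠ y then codegree H {x, y} - 0 else 0)
      ≤ (∑ x ∈ lower n (s + 1), ∑ y ∈ upper n (s + 1), ∑ z ∈ upper n (s + 1), tripleInd H x y z)
      + ∑ x ∈ upper n (s + 1), ∑ y ∈ upper n (s + 1), ∑ z ∈ upper n (s + 1), tripleInd H x y z := by
  have hrot : ∑ x ∈ lower n (s + 1), ∑ y ∈ upper n (s + 1), ∑ z ∈ upper n (s + 1),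
      tripleInd H x y z = ∑ x ∈ upper n (s + 1), ∑ y ∈ upper n (s + 1), ∑ z ∈ lower n (s + 1),
      tripleInd H x y z := by
    rw [Finset.sum_comm]
    refine Finset.sum_congr rfl fun y _ => ?_
    rw [Finset.sum_comm]
    exact Finset.sum_congr rfl fun z _ => Finset.sum_congr rfl fun x _ =>
      (tripleInd_rotate H y z x).symm
  rw [hrot, ← Finset.sum_add_distrib]
  refine Finset.sum_le_sum fun x _ => ?_
  rw [← Finset.sum_add_distrib]
  refine Finset.sum_le_sum fun y _ => ?_
  rw [← sum_lower_add_sum_upper]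
  split_ifs with hxy
  · rw [codegree_pair hH hxy, Nat.sub_zero]
  · exact Nat.zero_le _

theorem sum_upper_le_self {n s : ℕ} {H : Finset (Finset (Fin n))}
    (hH : H ⊆ Finset.powersetCard 3 Finset.univ) (hn : s + 1 ≤ n) {v : Fin n} (hv : (v : ℕ) = s) :
    (∑ x ∈ upper n (s + 1), ∑ y ∈ upper n (s + 1), if x ≠ y then codegree H {x, y} - s else 0)
      ≤ (∑ x ∈ upper n (s + 1), ∑ y ∈ upper n (s + 1), tripleInd H v x y)
      + ∑ x ∈ upper n (s + 1), ∑ y ∈ upper n (s + 1), ∑ z ∈ upper n (s + 1), tripleInd H x y z := by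
  rw [← Finset.sum_add_distrib]
  refine Finset.sum_le_sum fun x _ => ?_
  rw [← Finset.sum_add_distrib]
  refine Finset.sum_le_sum fun y _ => ?_
  split_ifs with hxy
  · rw [codegree_pair hH hxy, sum_lower_add_sum_upper (s + 1)]
    have hvl : v ∈ lower n (s + 1) := by rw [mem_lower]; omega
    rw [← Finset.add_sum_erase _ _ hvl]
    have h1 := Finset.sum_le_card_nsmul ((lower n (s + 1)).erase v) (fun z => tripleInd H x y z) 1
      fun z _ => tripleInd_le_one H x y z
    rw [Finset.card_erase_of_mem hvl, card_lower hn, smul_eq_mul] at h1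
    have := tripleInd_rotate H x y v
    omega
  · exact Nat.zero_le _

theorem sum_codegree {n : ℕ} {H : Finset (Finset (Fin n))}
    (hH : H ⊆ Finset.powersetCard 3 Finset.univ) :
    ∑ E ∈ Finset.powersetCard 2 (Finset.univ : Finset (Fin n)), codegree H E = 3 * H.card := by
  have h := Finset.sum_card_bipartiteAbove_eq_sum_card_bipartiteBelow
    (s := Finset.powersetCard 2 (Finset.univ : Finset (Fin n))) (t := H) (fun E F => E ⊆ F)
  have h2 : ∀ F ∈ H, (Finset.bipartiteBelow (fun E F : Finset (Fin n) => E ⊆ F)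
      (Finset.powersetCard 2 (Finset.univ : Finset (Fin n))) F).card = 3 := by
    intro F hF
    have : Finset.bipartiteBelow (fun E F : Finset (Fin n) => E ⊆ F)
      (Finset.powersetCard 2 (Finset.univ : Finset (Fin n))) F = Finset.powersetCard 2 F := by
      ext E
      simp [Finset.bipartiteBelow, Finset.mem_powersetCard, and_comm]
    rw [this, Finset.card_powersetCard, (Finset.mem_powersetCard.1 (hH hF)).2]
    rfl
  rw [Finset.sum_congr rfl h2, Finset.sum_const, smul_eq_mul, mul_comm] at h
  exact h

theorem excess_zero {n : ℕ} {H : Finset (Finset (Fin n))}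
    (hH : H ⊆ Finset.powersetCard 3 Finset.univ) : excess 0 H = 3 * H.card := sum_codegree hH

/-- If no pair of larger vertices lies in the link of vertex number `s`, then every member has a
vertex below `s`: any other triple could be shifted to one made of `s` and two larger vertices. -/
theorem IsShifted.subset_starFamily {n s : ℕ} {H : Finset (Finset (Fin n))} (h : IsShifted H)
    (hH : H ⊆ Finset.powersetCard 3 Finset.univ) {v : Fin n} (hv : (v : ℕ) = s)
    (h0 : ∑ x ∈ upper n (s + 1), ∑ y ∈ upper n (s + 1), tripleInd H v x y = 0) :
    H ⊆ starFamily n 3 s := by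
  have hnone : ∀ x y : Fin n, s + 1 ≤ (x : ℕ) → s + 1 ≤ (y : ℕ) →
      ({v, x, y} : Finset (Fin n)) ∉ H := by
    intro x y hx hy hm
    rw [Finset.sum_eq_zero_iff] at h0
    have h1 := h0 x (mem_upper.2 hx)
    rw [Finset.sum_eq_zero_iff] at h1
    have h2 := h1 y (mem_upper.2 hy)
    rw [tripleInd, if_pos hm] at h2
    exact one_ne_zero h2
  intro F hF
  refine Finset.mem_filter.2 ⟨hH hF, ?_⟩
  by_contra! hlarge
  -- the vertex to be replaced by `v`, which is `v` itself if it lies in `F`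
  obtain ⟨x, hx, hxv⟩ : ∃ x ∈ F, ∀ y ∈ F, y ≠ x → s + 1 ≤ (y : ℕ) := by
    by_cases hvF : v ∈ F
    · refine ⟨v, hvF, fun y hy hyv => ?_⟩
      have := hlarge y hy
      have : (y : ℕ) ≠ v := fun h => hyv (Fin.ext h)
      omega
    · obtain ⟨x, hx⟩ := Finset.card_pos.1
        (by rw [(Finset.mem_powersetCard.1 (hH hF)).2]; exact Nat.succ_pos 2 : 0 < F.card)
      refine ⟨x, hx, fun y hy _ => ?_⟩
      have := hlarge y hy
      have : (y : ℕ) ≠ v := fun h => hvF (Fin.ext h ▸ hy)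
      omega
  have hc : (F.erase x).card = 2 := by
    rw [Finset.card_erase_of_mem hx, (Finset.mem_powersetCard.1 (hH hF)).2]
  obtain ⟨y, z, hyz, he⟩ := Finset.card_eq_two.1 hc
  have hy : y ∈ F.erase x := he ▸ (by simp)
  have hz : z ∈ F.erase x := he ▸ (by simp)
  rw [Finset.mem_erase] at hy hz
  have hy' := hxv y hy.2 hy.1
  have hz' := hxv z hz.2 hz.1
  have hFm : ({x, y, z} : Finset (Fin n)) ∈ H := by rwa [← he, Finset.insert_erase hx]
  have hx' := hlarge x hx
  exact hnone y z hy' hz' (h.replace hH hFm (by rw [Fin.le_def]; omega)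
    (by rw [Ne, Fin.ext_iff]; omega) (by rw [Ne, Fin.ext_iff]; omega))

theorem block_arith {m s G g h : ℕ} (hlinks : G + (2 * s + 1) * g ≤ s * ((m + 1) * m))
    (hup : h ≤ 3 * s * g) (hs : 1 ≤ s) :
    2 * ((s + 1) * ((m + 1) * s) + (G + g)) + (G + g + h) + s * g
        ≤ 2 * (s * ((m + 1) * (m + s)) + (m + 1) * s) + (m + 1) * m * s ∧
      2 * (G + g) + (g + h) ≤ 2 * (s * ((m + 1) * m)) := by
  have h1 : g ≤ s * g := Nat.le_mul_of_pos_left g hs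
  constructor <;> nlinarith

/-- For shifted families the star is extremal both for the number of triples and for the excess
over `s`, and it is the only shifted family with that many triples. -/
theorem IsShifted.compare {n s : ℕ} (hs : 1 ≤ s) (hn : 7 * s + 6 ≤ n)
    {H : Finset (Finset (Fin n))} (h : IsShifted H) (hH : H ⊆ Finset.powersetCard 3 Finset.univ)
    (hfree : MatchingFree s H) :
    H.card ≤ (starFamily n 3 s).card ∧ excess s H ≤ excess s (starFamily n 3 s) ∧
      (H.card = (starFamily n 3 s).card → H = starFamily n 3 s) := by
  have hn1 : s + 1 ≤ n := by omega
  obtain ⟨v, hv⟩ : ∃ v : Fin n, (v : ℕ) = s := ⟨⟨s, by omega⟩, rfl⟩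
  have hlinks := h.sum_card_linkPairs_le (w := 2 * s + 1) hH hfree (by omega)
  have hup := h.sum_upper_le hs hH hfree (by omega) hv
  have hg : (linkPairs H (s + 1) s).card
      = ∑ x ∈ upper n (s + 1), ∑ y ∈ upper n (s + 1), tripleInd H v x y := by
    rw [← card_linkPairs hH, hv]
  have hG : ∑ x ∈ lower n (s + 1), ∑ y ∈ upper n (s + 1), ∑ z ∈ upper n (s + 1), tripleInd H x y z
      = ∑ i ∈ Finset.range s, (linkPairs H (s + 1) i).card
        + ∑ x ∈ upper n (s + 1), ∑ y ∈ upper n (s + 1), tripleInd H v x y := by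
    rw [← hg, ← Finset.sum_range_succ]
    refine Finset.sum_nbij Fin.val (fun x hx => ?_) (fun _ _ _ _ h => Fin.ext h)
      (fun i hi => ?_) fun x _ => (card_linkPairs hH _ _).symm
    · rw [mem_lower] at hx
      exact Finset.mem_range.2 hx
    · have hi := Finset.mem_range.1 (Finset.mem_coe.1 hi)
      exact ⟨⟨i, by omega⟩, Finset.mem_coe.2 (mem_lower.2 hi), rfl⟩
  have hsub := h.subset_starFamily hH hv
  rw [hg] at hlinks
  have e0 := two_mul_excess s 0 H
  have es := two_mul_excess s s H
  have s0 := two_mul_excess_starFamily (t := 0) hn1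
  have ss := two_mul_excess_starFamily (t := s) hn1
  have a0 := sum_lower_codegree_le (t := 0) hH hn1
  have as := sum_lower_codegree_le (t := s) hH hn1
  have b0 := sum_lower_upper_le (t := 0) hH hn1 (Nat.zero_le s)
  have bs := sum_lower_upper_le (t := s) hH hn1 le_rfl
  have c0 := sum_upper_le_zero (s := s) hH
  have cs := sum_upper_le_self hH hn1 hv
  rw [hG] at b0 bs c0
  rw [excess_zero hH] at e0
  rw [excess_zero (starFamily_subset n 3 s)] at s0
  obtain ⟨m, hm⟩ : ∃ m, n - (s + 1) = m + 1 := ⟨n - (s + 1) - 1, by omega⟩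
  have n2 : n - 2 - s = m := by omega
  have n3 : n - 2 - 0 = m + s := by omega
  rw [hm, Nat.add_sub_cancel] at hlinks
  rw [hm, n3, Nat.add_sub_cancel, Nat.sub_zero] at s0
  rw [hm, n2, Nat.add_sub_cancel, Nat.sub_self, mul_zero, mul_zero, add_zero, add_zero] at ss
  rw [hm, Nat.sub_zero] at b0
  rw [Nat.sub_self, mul_zero, mul_zero, zero_add] at bs
  generalize ∑ x ∈ upper n (s + 1), ∑ y ∈ upper n (s + 1), tripleInd H v x y = g at *
  generalize ∑ i ∈ Finset.range s, (linkPairs H (s + 1) i).card = G at *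
  obtain ⟨k0, ks⟩ := block_arith hlinks hup hs
  refine ⟨by omega, by omega, fun heq => ?_⟩
  have hsg : s * g = 0 := by omega
  have hg0 : g = 0 := (Nat.mul_eq_zero.1 hsg).resolve_left (by omega)
  exact Finset.eq_of_subset_of_card_le (hsub hg0) heq.ge

/-! ### Stars and shifts -/

/-- The star with centre `T`: all triples that meet `T`. -/
def starAt {n : ℕ} (T : Finset (Fin n)) : Finset (Finset (Fin n)) :=
  (Finset.powersetCard 3 Finset.univ).filter fun F => ∃ t ∈ F, t ∈ T

theorem mem_starAt {n : ℕ} {T F : Finset (Fin n)} :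
    F ∈ starAt T ↔ F.card = 3 ∧ ∃ t ∈ F, t ∈ T := by
  rw [starAt, Finset.mem_filter, Finset.mem_powersetCard_univ]

theorem starFamily_eq_starAt (n s : ℕ) : starFamily n 3 s = starAt (lower n s) := by
  simp only [starFamily, starAt, mem_lower]

theorem image_starAt {n : ℕ} (σ : Equiv.Perm (Fin n)) (T : Finset (Fin n)) :
    (starAt T).image (fun F => F.image σ) = starAt (T.image σ) := by
  ext G
  simp only [Finset.mem_image, mem_starAt]
  constructor
  · rintro ⟨F, ⟨hF, t, ht, htT⟩, rfl⟩
    exact ⟨by rwa [Finset.card_image_of_injective _ σ.injective],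
      σ t, Finset.mem_image_of_mem _ ht, t, htT, rfl⟩
  · rintro ⟨hG, _, hu, t, htT, rfl⟩
    refine ⟨G.image σ.symm, ⟨by rwa [Finset.card_image_of_injective _ σ.symm.injective], t,
      Finset.mem_image.2 ⟨_, hu, by simp⟩, htT⟩, ?_⟩
    rw [Finset.image_image]
    simp

theorem card_starAt_image {n : ℕ} (σ : Equiv.Perm (Fin n)) (T : Finset (Fin n)) :
    (starAt (T.image σ)).card = (starAt T).card := by
  rw [← image_starAt, Finset.card_image_of_injective _ (Finset.image_injective σ.injective)]

theorem familyIso_starFamily {n s : ℕ} (hs : s ≤ n) {T : Finset (Fin n)} (hT : T.card = s) :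
    FamilyIso (starAt T) (starFamily n 3 s) := by
  have e : {x // x ∈ T} ≃ {x // x ∈ lower n s} :=
    Finset.equivOfCardEq (by rw [hT, card_lower hs])
  refine ⟨e.extendSubtype, ?_⟩
  rw [image_starAt, starFamily_eq_starAt]
  congr 1
  refine Finset.eq_of_subset_of_card_le (fun y hy => ?_) ?_
  · obtain ⟨x, hx, rfl⟩ := Finset.mem_image.1 hy
    exact e.extendSubtype_mem x hx
  · rw [Finset.card_image_of_injective _ (Equiv.injective _), hT, card_lower hs]

/-- Two disjoint members of `H`, of which the first meets `T` at most in `i` and the second does not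
meet `T`, extend to a matching of size `s + 1` by triples through the other vertices of `T`. -/
theorem MatchingFree.not_disjoint {n s : ℕ} (hn : 3 * s + 6 ≤ n) {H : Finset (Finset (Fin n))}
    (hH : H ⊆ Finset.powersetCard 3 Finset.univ) (hfree : MatchingFree s H)
    {T : Finset (Fin n)} (hT : T.card = s) {i j : Fin n} (hi : i ∈ T)
    (hrest : ∀ F : Finset (Fin n), F.card = 3 → (∃ t ∈ F, t ∈ T) → i ∉ F → j ∉ F → F ∈ H)
    (hjT : j ∉ T)
    {F₁ F₂ : Finset (Fin n)} (h₁ : F₁ ∈ H) (h₂ : F₂ ∈ H) (hF₁ : ∀ t ∈ F₁, t ∈ T → t = i)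
    (hF₂ : ∀ t ∈ F₂, t ∉ T) : ¬ Disjoint F₁ F₂ := by
  intro hd
  have c₁ := (Finset.mem_powersetCard.1 (hH h₁)).2
  have c₂ := (Finset.mem_powersetCard.1 (hH h₂)).2
  have hs : 1 ≤ s := hT ▸ Finset.card_pos.2 ⟨i, hi⟩
  set W : Finset (Fin n) := Finset.univ \ (T ∪ F₁ ∪ F₂ ∪ {j}) with hW
  have hWcard : 2 * (s - 1) ≤ W.card := by
    have h1 : (T ∪ F₁ ∪ F₂ ∪ {j}).card ≤ s + 3 + 3 + 1 := by
      refine (Finset.card_union_le _ _).trans (Nat.add_le_add ?_ (Finset.card_singleton j).le)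
      refine (Finset.card_union_le _ _).trans (Nat.add_le_add ?_ c₂.le)
      exact (Finset.card_union_le _ _).trans (Nat.add_le_add hT.le c₁.le)
    rw [hW, Finset.card_sdiff_of_subset (Finset.subset_univ _), Finset.card_univ, Fintype.card_fin]
    omega
  have hWmem : ∀ w ∈ W, w ∉ T ∧ w ∉ F₁ ∧ w ∉ F₂ ∧ w ≠ j := by
    intro w hw
    simp only [hW, Finset.mem_sdiff, Finset.mem_union, Finset.mem_singleton] at hw
    tauto
  obtain ⟨e⟩ : Nonempty ({t // t ∈ T.erase i} × Bool ↪ {w // w ∈ W}) := by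
    refine Function.Embedding.nonempty_of_card_le ?_
    rw [Fintype.card_prod, Fintype.card_bool, Fintype.card_coe, Fintype.card_coe,
      Finset.card_erase_of_mem hi, hT]
    omega
  set B : {t // t ∈ T.erase i} → Finset (Fin n) := fun t => {(t : Fin n), (e (t, false) : Fin n),
    (e (t, true) : Fin n)} with hB
  have ht : ∀ t : {t // t ∈ T.erase i}, (t : Fin n) ≠ i ∧ (t : Fin n) ∈ T := fun t =>
    Finset.mem_erase.1 t.2
  have hBmem : ∀ t v, v ∈ B t → v = t ∨ ∃ b, v = e (t, b) := by
    intro t v hv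
    simp only [hB, Finset.mem_insert, Finset.mem_singleton] at hv
    rcases hv with hv | hv | hv
    · exact Or.inl hv
    · exact Or.inr ⟨_, hv⟩
    · exact Or.inr ⟨_, hv⟩
  have hB₁ : ∀ t, Disjoint F₁ (B t) := fun t => Finset.disjoint_left.2 fun v hv hv' => by
    rcases hBmem t v hv' with rfl | ⟨b, rfl⟩
    · exact (ht t).1 (hF₁ _ hv (ht t).2)
    · exact (hWmem _ (e (t, b)).2).2.1 hv
  have hB₂ : ∀ t, Disjoint F₂ (B t) := fun t => Finset.disjoint_left.2 fun v hv hv' => by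
    rcases hBmem t v hv' with rfl | ⟨b, rfl⟩
    · exact hF₂ _ hv (ht t).2
    · exact (hWmem _ (e (t, b)).2).2.2.1 hv
  have hBB : ∀ t t', t ≠ t' → Disjoint (B t) (B t') := fun t t' hne =>
    Finset.disjoint_left.2 fun v hv hv' => by
      rcases hBmem t v hv with rfl | ⟨b, rfl⟩ <;> rcases hBmem t' _ hv' with h | ⟨b', h⟩
      · exact hne (Subtype.ext h)
      · exact (hWmem _ (e (t', b')).2).1 (h ▸ (ht t).2)
      · exact (hWmem _ (e (t, b)).2).1 (h ▸ (ht t').2)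
      · exact hne (congrArg Prod.fst (e.injective (Subtype.ext h)))
  have hBH : ∀ t, B t ∈ H := by
    intro t
    have hne : ∀ b, (t : Fin n) ≠ e (t, b) := fun b h => (hWmem _ (e (t, b)).2).1 (h ▸ (ht t).2)
    refine hrest _ ?_ ⟨t, by simp [hB], (ht t).2⟩ ?_ ?_
    · refine Finset.card_eq_three.2 ⟨_, _, _, hne _, hne _, fun h => ?_, rfl⟩
      simpa using e.injective (Subtype.ext h)
    · intro hv
      rcases hBmem t _ hv with h | ⟨b, h⟩
      · exact (ht t).1 h.symm
      · exact (hWmem _ (e (t, b)).2).1 (h ▸ hi)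
    · intro hv
      rcases hBmem t _ hv with h | ⟨b, h⟩
      · exact hjT (h ▸ (ht t).2)
      · exact (hWmem _ (e (t, b)).2).2.2.2 h.symm
  refine hfree.not_pairwise (ι := Option (Option {t // t ∈ T.erase i})) ?_
    (fun a => match a with
      | none => F₁
      | some none => F₂
      | some (some t) => B t) ?_ ?_
  · rw [Fintype.card_option, Fintype.card_option, Fintype.card_coe, Finset.card_erase_of_mem hi, hT]
    omega
  · rintro (_ | _ | t)
    · exact h₁
    · exact h₂
    · exact hBH t
  · rintro (_ | _ | t) (_ | _ | t') hne
    · exact absurd rfl hne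
    · exact hd
    · exact hB₁ t'
    · exact hd.symm
    · exact absurd rfl hne
    · exact hB₂ t'
    · exact (hB₁ t).symm
    · exact (hB₂ t).symm
    · exact hBB t t' fun h => hne (by rw [h])

theorem exists_pair_not_mem {n : ℕ} (X : Finset (Fin n)) (hX : X.card + 2 ≤ n) :
    ∃ a b, a ≠ b ∧ a ∉ X ∧ b ∉ X := by
  have : 1 < (Finset.univ \ X).card := by
    rw [Finset.card_sdiff_of_subset (Finset.subset_univ _), Finset.card_univ, Fintype.card_fin]
    omega
  obtain ⟨a, ha, b, hb, hab⟩ := Finset.one_lt_card.1 this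
  exact ⟨a, b, hab, by simpa using ha, by simpa using hb⟩

/-- If a shift turns a family with small matching number into a star, then the family was a star.
When the centre contains `i` but not `j`, each triple that meets the centre only in `i` comes either
from itself or from its mirror image, and the choice is the same for all of them, since otherwise
there would be a larger matching. -/
theorem exists_eq_starAt_of_shift {n s : ℕ} (hn : 3 * s + 9 ≤ n) {H : Finset (Finset (Fin n))}
    (hH : H ⊆ Finset.powersetCard 3 Finset.univ) (hfree : MatchingFree s H)
    {T : Finset (Fin n)} (hT : T.card = s) {i j : Fin n} (hij : i ≠ j)
    (hS : shift i j H = starAt T) : ∃ T' : Finset (Fin n), T'.card = s ∧ H = starAt T' := by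
  have hind := shift_indicator i j H
  rw [hS] at hind
  have hcardH : (starAt T).card = H.card := by rw [← hS, card_shift]
  have hmem : ∀ F : Finset (Fin n), F ∈ starAt T ↔
      (F ∈ H ∧ swapSet i j F ∈ H) ∨ (i ∈ F ∧ (F ∈ H ∨ swapSet i j F ∈ H)) := fun F => by
    rw [← hS, mem_shift]
  have h3 : ∀ F ∈ H, F.card = 3 := fun F hF => (Finset.mem_powersetCard.1 (hH hF)).2
  by_cases hsym : i ∈ T ↔ j ∈ T
  · -- the star is symmetric, so that the indicator identity leaves no choice
    refine ⟨T, hT, Finset.ext fun F => ?_⟩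
    have hTs := swapSet_eq_self hsym
    have hFs : swapSet i j F ∈ starAt T ↔ F ∈ starAt T := by
      rw [mem_starAt, mem_starAt, card_swapSet]
      refine and_congr_right fun _ => ⟨?_, ?_⟩
      · rintro ⟨t, ht, htT⟩
        exact ⟨_, mem_swapSet.1 ht, by rwa [← hTs, mem_swapSet] at htT⟩
      · rintro ⟨t, ht, htT⟩
        exact ⟨Equiv.swap i j t, mem_swapSet.2 (by simpa using ht), by
          rwa [← hTs, mem_swapSet, Equiv.swap_apply_self]⟩
    have h := hind F
    simp only [hFs] at h
    split_ifs at h <;> simp_all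
  by_cases hiT : i ∈ T
  swap
  · -- a star with `j` but not `i` in its centre is not fixed by the shift
    exfalso
    have hjT : j ∈ T := by tauto
    obtain ⟨a, b, hab, ha, hb⟩ := exists_pair_not_mem (insert i T) (by
      have := Finset.card_insert_le i T
      omega)
    rw [Finset.mem_insert, not_or] at ha hb
    have haj : a ≠ j := by rintro rfl; exact ha.2 hjT
    have hbj : b ≠ j := by rintro rfl; exact hb.2 hjT
    have hF : ({j, a, b} : Finset (Fin n)) ∈ starAt T := mem_starAt.2
      ⟨Finset.card_eq_three.2 ⟨j, a, b, haj.symm, hbj.symm, hab, rfl⟩, j, by simp, hjT⟩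
    have hi : i ∉ ({j, a, b} : Finset (Fin n)) := by
      simp only [Finset.mem_insert, Finset.mem_singleton, not_or]
      exact ⟨hij, Ne.symm ha.1, Ne.symm hb.1⟩
    have h1 := (hmem _).1 hF
    have h2 : ({i, a, b} : Finset (Fin n)) ∈ starAt T := by
      rw [hmem]
      rw [swapSet_triple ha.1 haj hb.1 hbj] at h1
      exact Or.inr ⟨by simp, Or.inl (by tauto)⟩
    obtain ⟨_, t, ht, htT⟩ := mem_starAt.1 h2
    simp only [Finset.mem_insert, Finset.mem_singleton] at ht
    rcases ht with rfl | rfl | rfl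
    · exact hiT htT
    · exact ha.2 htT
    · exact hb.2 htT
  have hjT : j ∉ T := by tauto
  have hrest : ∀ F : Finset (Fin n), F.card = 3 → (∃ t ∈ F, t ∈ T) → i ∉ F → j ∉ F → F ∈ H := by
    intro F hF ht hi _
    have := (hmem F).1 (mem_starAt.2 ⟨hF, ht⟩)
    tauto
  by_cases hA : ∃ F₁ ∈ H, j ∉ F₁ ∧ ∀ t ∈ F₁, t ∈ T → t = i
  · by_cases hB : ∃ F₂ ∈ H, ∀ t ∈ F₂, t ∉ T
    · exfalso
      obtain ⟨F₁, h₁, hj₁, hF₁⟩ := hA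
      obtain ⟨F₂, h₂, hF₂⟩ := hB
      have c₁ := h3 _ h₁
      have c₂ := h3 _ h₂
      obtain ⟨a, b, hab, ha, hb⟩ := exists_pair_not_mem (T ∪ F₁ ∪ F₂ ∪ {j}) (by
        have h1 := Finset.card_union_le (T ∪ F₁ ∪ F₂) {j}
        have h2 := Finset.card_union_le (T ∪ F₁) F₂
        have h3 := Finset.card_union_le T F₁
        rw [Finset.card_singleton] at h1
        omega)
      simp only [Finset.mem_union, Finset.mem_singleton, not_or] at ha hb
      obtain ⟨⟨⟨haT, ha₁⟩, ha₂⟩, haj⟩ := ha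
      obtain ⟨⟨⟨hbT, hb₁⟩, hb₂⟩, hbj⟩ := hb
      have hai : a ≠ i := by rintro rfl; exact haT hiT
      have hbi : b ≠ i := by rintro rfl; exact hbT hiT
      have hmem' : ({i, a, b} : Finset (Fin n)) ∈ starAt T := mem_starAt.2
        ⟨Finset.card_eq_three.2 ⟨i, a, b, hai.symm, hbi.symm, hab, rfl⟩, i, by simp, hiT⟩
      have hjab : ∀ t ∈ ({j, a, b} : Finset (Fin n)), t ∉ T := by
        intro t ht
        simp only [Finset.mem_insert, Finset.mem_singleton] at ht
        rcases ht with rfl | rfl | rfl <;> assumption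
      have h := hind {j, a, b}
      rw [swapSet_triple hai haj hbi hbj, if_pos hmem'] at h
      by_cases hiab : ({i, a, b} : Finset (Fin n)) ∈ H
      · refine hfree.not_disjoint (by omega) hH hT hiT hrest hjT hiab h₂ ?_ hF₂ ?_
        · intro t ht htT
          simp only [Finset.mem_insert, Finset.mem_singleton] at ht
          rcases ht with rfl | rfl | rfl
          · rfl
          · exact absurd htT haT
          · exact absurd htT hbT
        · rw [Finset.disjoint_left]
          intro t ht
          simp only [Finset.mem_insert, Finset.mem_singleton] at ht
          rcases ht with rfl | rfl | rfl
          · exact fun h => hF₂ _ h hiT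
          · exact ha₂
          · exact hb₂
      · have hjabH : ({j, a, b} : Finset (Fin n)) ∈ H := by
          by_contra hn
          rw [if_neg hiab, if_neg hn] at h
          omega
        refine hfree.not_disjoint (by omega) hH hT hiT hrest hjT h₁ hjabH hF₁ hjab ?_
        rw [disjoint_comm, Finset.disjoint_left]
        intro t ht
        simp only [Finset.mem_insert, Finset.mem_singleton] at ht
        rcases ht with rfl | rfl | rfl <;> assumption
    · push Not at hB
      exact ⟨T, hT, Finset.eq_of_subset_of_card_le
        (fun F hF => mem_starAt.2 ⟨h3 F hF, hB F hF⟩) hcardH.le⟩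
  · push Not at hA
    refine ⟨swapSet i j T, by rw [card_swapSet, hT], Finset.eq_of_subset_of_card_le
      (fun F hF => mem_starAt.2 ⟨h3 F hF, ?_⟩) ?_⟩
    · by_cases hjF : j ∈ F
      · exact ⟨j, hjF, mem_swapSet.2 (by rwa [Equiv.swap_apply_right])⟩
      · obtain ⟨t, htF, htT, hti⟩ := hA F hF hjF
        refine ⟨t, htF, mem_swapSet.2 ?_⟩
        rwa [Equiv.swap_apply_of_ne_of_ne hti (by rintro rfl; exact hjF htF)]
    · rw [swapSet, card_starAt_image, hcardH]

/-- The star is extremal for the number of triples and for the excess over `s` among all families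
with matching number at most `s`, by induction on the weight along shifts. -/
theorem MatchingFree.compare {n s : ℕ} (hs : 1 ≤ s) (hn : 7 * s + 6 ≤ n)
    (H : Finset (Finset (Fin n))) (hH : H ⊆ Finset.powersetCard 3 Finset.univ)
    (hfree : MatchingFree s H) :
    H.card ≤ (starFamily n 3 s).card ∧ excess s H ≤ excess s (starFamily n 3 s) ∧
      (H.card = (starFamily n 3 s).card → ∃ T : Finset (Fin n), T.card = s ∧ H = starAt T) := by
  induction hw : weight H using Nat.strong_induction_on generalizing H with
  | _ k ih =>
    subst hw
    by_cases hsh : IsShifted H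
    · obtain ⟨h1, h2, h3⟩ := hsh.compare hs hn hH hfree
      exact ⟨h1, h2, fun h => ⟨lower n s, card_lower (by omega), by
        rw [h3 h, starFamily_eq_starAt]⟩⟩
    · unfold IsShifted at hsh
      push Not at hsh
      obtain ⟨i, j, hij, hne⟩ := hsh
      obtain ⟨h1, h2, h3⟩ := ih _ (weight_shift_lt hij hne) (shift i j H)
        (shift_subset_powersetCard hH) (hfree.shifted i j) rfl
      rw [card_shift] at h1 h3
      refine ⟨h1, (excess_le_shift i j s H).trans h2, fun h => ?_⟩
      obtain ⟨T, hT, hS⟩ := h3 h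
      exact exists_eq_starAt_of_shift (by omega) hH hfree hT hij.ne hS

/-! ### From truncated sums to powers -/

theorem coNorm_eq_of_familyIso {n : ℕ} (k p : ℕ) {H K : Finset (Finset (Fin n))}
    (h : FamilyIso H K) : coNorm k p H = coNorm k p K := by
  obtain ⟨σ, rfl⟩ := h
  unfold coNorm
  refine Finset.sum_nbij (fun E => E.image σ) ?_ ?_ ?_ ?_
  · intro E hE
    rw [Finset.mem_powersetCard_univ] at hE ⊢
    rwa [Finset.card_image_of_injective _ σ.injective]
  · exact fun _ _ _ _ h => Finset.image_injective σ.injective h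
  · intro E hE
    rw [Finset.mem_coe, Finset.mem_powersetCard_univ] at hE
    refine ⟨E.image σ.symm, ?_, ?_⟩
    · rwa [Finset.mem_coe, Finset.mem_powersetCard_univ,
        Finset.card_image_of_injective _ σ.symm.injective]
    · simp [Finset.image_image]
  · intro E _
    congr 1
    unfold codegree
    rw [Finset.filter_image, Finset.card_image_of_injective _
      (Finset.image_injective σ.injective)]
    congr 1
    ext F
    simp only [Finset.mem_filter, Finset.image_subset_image_iff σ.injective]

/-- The function `d ↦ d ^ (q + 1)` lies below the piecewise linear function that agrees with it at
`0`, `s` and `D`; its slope is at least one near `0`. -/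
theorem exists_chord (s D : ℕ) (hs : 1 ≤ s) (hD : s ≤ D) (q : ℕ) : ∃ a K : ℕ, 1 ≤ a ∧
    (∀ d ≤ D, d ^ (q + 1) ≤ a * d + K * (d - s)) ∧ s ^ (q + 1) = a * s ∧
      D ^ (q + 1) = a * D + K * (D - s) := by
  induction q with
  | zero => exact ⟨1, 0, le_rfl, by simp, by simp, by simp⟩
  | succ q ih =>
    obtain ⟨a, K, ha, h1, h2, h3⟩ := ih
    obtain ⟨c, rfl⟩ := Nat.exists_eq_add_of_le hD
    refine ⟨a * s, (a + K) * (s + c), Nat.mul_pos ha hs, fun d hd => ?_, ?_, ?_⟩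
    · rw [pow_succ]
      refine (Nat.mul_le_mul_right d (h1 d hd)).trans ?_
      rcases le_total d s with hds | hds
      · rw [Nat.sub_eq_zero_of_le hds, mul_zero, mul_zero, add_zero, add_zero, mul_right_comm]
        rw [mul_right_comm a s d]
        exact Nat.mul_le_mul_left _ hds
      · obtain ⟨b, rfl⟩ := Nat.exists_eq_add_of_le hds
        rw [Nat.add_sub_cancel_left]
        calc (a * (s + b) + K * b) * (s + b)
            = a * s * (s + b) + (a + K) * (s + b) * b := by ring
          _ ≤ _ := by gcongr
    · rw [pow_succ, h2]
    · rw [pow_succ, h3, Nat.add_sub_cancel_left]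
      ring

theorem theorem1p7 (n s p : ℕ) (hs : 1 ≤ s) (hp : 1 ≤ p) (hn : 7 * s + 6 ≤ n)
    (H : Finset (Finset (Fin n)))
    (hH : H ⊆ Finset.powersetCard 3 (Finset.univ : Finset (Fin n)))
    (hν : matchingNumber H = s) :
    coNorm 3 p H ≤ coNorm 3 p (starFamily n 3 s) ∧
      (coNorm 3 p H = coNorm 3 p (starFamily n 3 s) ↔ FamilyIso H (starFamily n 3 s)) := by
  have hfree : MatchingFree s H := matchingFree_of_matchingNumber_le (fun F hF => by
    rw [← Finset.card_pos, (Finset.mem_powersetCard.1 (hH hF)).2]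
    exact Nat.succ_pos 2) hν.le
  obtain ⟨hcard, hexc, huniq⟩ := hfree.compare hs hn H hH
  obtain ⟨q, rfl⟩ := Nat.exists_eq_add_of_le' hp
  obtain ⟨a, K, ha, hchord, hats, hatD⟩ := exists_chord s (n - 2) hs (by omega) q
  have hpair : ∀ E ∈ Finset.powersetCard 2 (Finset.univ : Finset (Fin n)),
      ∃ x y, x ≠ y ∧ E = {x, y} := fun E hE =>
    Finset.card_eq_two.1 (Finset.mem_powersetCard_univ.1 hE)
  have hle : coNorm 3 (q + 1) H ≤ a * (3 * H.card) + K * excess s H := by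
    rw [← sum_codegree hH, excess, Finset.mul_sum, Finset.mul_sum, ← Finset.sum_add_distrib]
    refine Finset.sum_le_sum fun E hE => hchord _ ?_
    obtain ⟨x, y, hxy, rfl⟩ := hpair E hE
    exact codegree_pair_le hH hxy
  -- the codegrees of the star take only the values `s` and `n - 2`, where the bound is attained
  have heq : coNorm 3 (q + 1) (starFamily n 3 s)
      = a * (3 * (starFamily n 3 s).card) + K * excess s (starFamily n 3 s) := by
    rw [← sum_codegree (starFamily_subset n 3 s), excess, Finset.mul_sum, Finset.mul_sum,
      ← Finset.sum_add_distrib]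
    refine Finset.sum_congr rfl fun E hE => ?_
    obtain ⟨x, y, hxy, rfl⟩ := hpair E hE
    rw [codegree_starFamily (by omega) hxy]
    split_ifs
    · exact hatD
    · rw [Nat.sub_self, mul_zero, add_zero, hats]
  have hK : K * excess s H ≤ K * excess s (starFamily n 3 s) := Nat.mul_le_mul_left K hexc
  have hA : a * (3 * H.card) ≤ a * (3 * (starFamily n 3 s).card) := by gcongr
  refine ⟨by omega, fun h => ?_, coNorm_eq_of_familyIso 3 (q + 1)⟩
  have hA' : a * (3 * H.card) = a * (3 * (starFamily n 3 s).card) := by omega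
  have hcard' := Nat.eq_of_mul_eq_mul_left ha hA'
  obtain ⟨T, hT, rfl⟩ := huniq (by omega)
  exact familyIso_starFamily (by omega) hT
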